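/- Let $N\ge 1$ and let $e^{i\theta_1},\dots,e^{i\theta_N}$ be the eigenvalues of the circular orthogonal ensemble (COE, $\beta=1$), with joint density $$\frac1{Z_N}\prod_{1\le j<k\le N}\bigl|e^{i\theta_j}-e^{i\theta_k}\bigr|^{\beta},\qquad \beta=1,$$ with respect to $\prod_j d\theta_j/2\pi$, where $Z_N$ is the normalisation. Let $\rho_{(1)}$ and $\rho_{(2)}$ be the one- and two-point correlation functions, i.e. $N$, respectively $N(N-1)$, times the integral of the joint density over the remaining $N-1$, respectively $N-2$, angles with respect to $d\theta/2\pi$ each (so $\rho_{(2)}=0$ if $N=1$). Put $\rho_{(2)C}(\theta_1,\theta_2)=\rho_{(2)}(\theta_1,\theta_2)-\rho_{(1)}(\theta_1)\rho_{(1)}(\theta_2)$, which depends only on $\theta=\theta_2-\theta_1$, and let $$m_k=\int_0^{2\pi}\frac{d\theta}{2\pi}\,e^{-ik\theta}\rho_{(2)C}(\theta),\qquad k\in\mathbb Z,$$ be its Fourier coefficients. Let $\psi=\Gamma'/\Gamma$ be the digamma function, and $x\,\Theta(x)=\max(x,0)$. Then: 1. $m_0=-N$. For $k\ge 1$, $$m_k=-(N-|k|)\Theta(N-|k|)+\min(k,N)-k\Bigl[\psi\bigl(\tfrac12(N+1)+k\bigr)-\psi\bigl(\tfrac12(N+1)+\max(0,k-N)\bigr)\Bigr],$$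 and for $k\le -1$, $$m_k=-(N-|k|)\Theta(N-|k|)+\min(-k,N)+k\Bigl[\psi\bigl(\tfrac12(N+1)-k\bigr)-\psi\bigl(\tfrac12(N+1)+\max(0,-k-N)\bigr)\Bigr].$$ 2. If $N\ge2$, then $m_k\ne0$ for every $k\in\mathbb Z$. 3. For $1\le k\le N+1$, $$m_k=-N+2k-2k\sum_{j=1}^{k}\frac1{N+2j-1}.$$ -/

import Mathlib

open Real MeasureTheory

noncomputable section

namespace CircularEnsemble

/-- The period `2π` is positive. -/
instance twoPiPos : Fact (0 < 2 * π) := ⟨Real.two_pi_pos⟩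

/-- An angle, i.e. an element of `ℝ / 2πℤ`. -/
abbrev Angle : Type := AddCircle (2 * π)

/-- The unnormalised eigenvalue density `∏_{j<k} |e^{iθ_j} - e^{iθ_k}|^β` of the circular
`β` ensemble with `n` eigenvalues `e^{iθ_1}, …, e^{iθ_n}`. -/
def weight (β : ℝ) {n : ℕ} (θ : Fin n → Angle) : ℝ :=
  ∏ j : Fin n, ∏ k ∈ Finset.Ioi j,
    ‖((θ j).toCircle : ℂ) - ((θ k).toCircle : ℂ)‖ ^ β

/-- The product of `n` copies of the normalised measure `dθ / 2π = dζ / (2πiζ)`. -/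
def torusMeasure (n : ℕ) : Measure (Fin n → Angle) :=
  Measure.pi fun _ => AddCircle.haarAddCircle

/-- The normalisation `Z_N`. -/
def partitionFunction (β : ℝ) (N : ℕ) : ℝ :=
  ∫ θ : Fin N → Angle, weight β θ ∂torusMeasure N

/-- The eigenvalue density `ρ_(1)(θ₁)` with respect to `dθ₁ / 2π`. It is meant for `N ≥ 1`, where
`N - 1` is the number of angles that are integrated out. -/
def rho1 (β : ℝ) (N : ℕ) (θ₁ : Angle) : ℝ :=
  (N : ℝ) / partitionFunction β N *
    ∫ φ : Fin (N - 1) → Angle, weight β (Fin.cons θ₁ φ : Fin (N - 1 + 1) → Angle)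
      ∂torusMeasure (N - 1)

/-- The two-point correlation function `ρ_(2)(θ₁, θ₂)` with respect to `dθ₁ dθ₂ / (2π)²`; for
`N ≥ 2`, `N - 2` is the number of angles that are integrated out. For `N = 1` the prefactor
`N (N - 1)` makes it zero, as it should be. -/
def rho2 (β : ℝ) (N : ℕ) (θ₁ θ₂ : Angle) : ℝ :=
  (N : ℝ) * ((N : ℝ) - 1) / partitionFunction β N *
    ∫ φ : Fin (N - 2) → Angle,
      weight β (Fin.cons θ₁ (Fin.cons θ₂ φ : Fin (N - 2 + 1) → Angle) : Fin (N - 2 + 1 + 1) → Angle)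
      ∂torusMeasure (N - 2)

/-- The connected two-point correlation function
`ρ_(2)C(θ₁, θ₂) = ρ_(2)(θ₁, θ₂) - ρ_(1)(θ₁) ρ_(1)(θ₂)`. -/
def rho2C (β : ℝ) (N : ℕ) (θ₁ θ₂ : Angle) : ℝ :=
  rho2 β N θ₁ θ₂ - rho1 β N θ₁ * rho1 β N θ₂

/-- The moment `m_k`: the `k`-th Fourier coefficient of `ρ_(2)C` as a function of the difference
`θ = θ₂ - θ₁`, that is `m_k = ∫ e^{-ikθ} ρ_(2)C(0, θ) dθ / 2π`. -/
def moment (β : ℝ) (N : ℕ) (k : ℤ) : ℂ :=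
  fourierCoeff (fun θ : Angle => (rho2C β N 0 θ : ℂ)) k

lemma weight_add_const (β : ℝ) {n : ℕ} (c : Angle) (θ : Fin n → Angle) :
    weight β (fun i => c + θ i) = weight β θ := by
  unfold weight
  refine Finset.prod_congr rfl fun j _ => Finset.prod_congr rfl fun k _ => ?_
  rw [AddCircle.toCircle_add, AddCircle.toCircle_add, Circle.coe_mul, Circle.coe_mul, ← mul_sub,
    norm_mul, Circle.norm_coe, one_mul]

lemma integral_add_const {n : ℕ} (c : Angle) (f : (Fin n → Angle) → ℝ) :
    ∫ φ, f (fun i => c + φ i) ∂torusMeasure n = ∫ φ, f φ ∂torusMeasure n := by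
  unfold torusMeasure
  exact integral_add_left_eq_self f (fun _ => c)

/-- Rotation invariance: `ρ_(2)C` depends only on the difference of the angles, so that the
moments are the Fourier coefficients of `ρ_(2)C(θ₁, θ₂)` in `θ = θ₂ - θ₁` for every `θ₁`. -/
lemma rho2C_eq (β : ℝ) (N : ℕ) (θ₁ θ₂ : Angle) :
    rho2C β N θ₁ θ₂ = rho2C β N 0 (θ₂ - θ₁) := by
  have h1 : ∀ c x : Angle, rho1 β N (c + x) = rho1 β N x := by
    intro c x
    unfold rho1
    rw [← integral_add_const c]
    congr 2
    funext φ
    rw [← weight_add_const β c (Fin.cons x φ)]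
    congr 1
    funext i
    refine Fin.cases ?_ (fun i => ?_) i <;> simp
  have h2 : ∀ c x y : Angle, rho2 β N (c + x) (c + y) = rho2 β N x y := by
    intro c x y
    unfold rho2
    rw [← integral_add_const c]
    congr 2
    funext φ
    rw [← weight_add_const β c (Fin.cons x (Fin.cons y φ))]
    congr 1
    funext i
    refine Fin.cases ?_ (fun i => Fin.cases ?_ (fun i => ?_) i) i <;> simp
  have e1 := h1 θ₁ 0
  have e2 := h1 θ₁ (θ₂ - θ₁)
  have e3 := h2 θ₁ 0 (θ₂ - θ₁)
  rw [add_zero] at e1 e3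
  rw [add_sub_cancel] at e2 e3
  unfold rho2C
  rw [e1, e2, e3]

end CircularEnsemble

end

noncomputable section

namespace CircularEnsemble

open Equiv

/-! The moments are ratios of integrals against the weight, and for β = 1 such integrals are
Pfaffians. With angles represented in (0, 2π], each |e^{iθ_j} - e^{iθ_k}| equals, up to a constant,
sgn(θ_k - θ_j) (e^{iθ_k} - e^{iθ_j}) e^{-iθ_j/2} e^{-iθ_k/2}. Hence the weight is a constant times
the sign of the ordering times the determinant of the functions e^{iqθ}, with q running over `base
N` (`exists_weight_eq`).

De Bruijn's formula (`antisymConst_mul_signedInt`) turns the signed integral of such a determinant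
into a Pfaffian sum of the pairings ∫∫ sgn(y - x) e^{ipx} e^{iqy}. For nonzero exponents in the
relevant coset this pairing vanishes unless p + q = 0, and is then i/(πq) (`pairInt_eq`). So only
exponent sets symmetric under negation contribute, with a value proportional to the product of 1/q
over one member of each pair.

Inserting e^{ik(θ_j - θ_l)} and summing over j ≠ l produces the determinants in which exponent a is
raised and exponent b lowered by k (`sum_wave_mul_detWave`). Two kinds survive (`signedInt_shift`):
the shift swaps two exponents, giving -1, or it moves a symmetric pair outwards beyond the range,
giving q_a/(q_a + k). Their sum is the rational expression `closedMoment`. The recurrence ψ(s + 1) =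
ψ(s) + 1/s yields the digamma form.

For N ≥ 2 and k ≥ 1 the closed form is negative: for k ≥ N by the symmetry of the exponents, and for
smaller k by descent from k + 1 to k. -/

/-! ### The sign of an ordering and its expression through pairs -/

/-- The sign of the permutation that sorts `x`, and zero if `x` has a repeated entry. -/
def ordSign {N : ℕ} (x : Fin N → ℝ) : ℝ :=
  ∏ j : Fin N, ∏ k ∈ Finset.Ioi j, Real.sign (x k - x j)

lemma ordSign_comp_perm {N : ℕ} (x : Fin N → ℝ) (σ : Perm (Fin N)) :
    ordSign (x ∘ σ) = ((Perm.sign σ : ℤ) : ℝ) * ordSign x := by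
  unfold ordSign
  have := Equiv.Perm.prod_Ioi_comp_eq_sign_mul_prod σ
    (f := fun j k => Real.sign (x k - x j)) (fun i j => by
      rw [← Real.sign_neg, neg_sub])
  simpa using this

lemma ordSign_of_strictMono {N : ℕ} {x : Fin N → ℝ} (hx : StrictMono x) : ordSign x = 1 := by
  unfold ordSign
  refine Finset.prod_eq_one fun j _ => Finset.prod_eq_one fun k hk => ?_
  exact Real.sign_of_pos (sub_pos.2 (hx (Finset.mem_Ioi.1 hk)))

/-- `n` pairs of slots followed by `r` single slots. -/
abbrev Slot (n r : ℕ) : Type := (Fin n × Bool) ⊕ Fin r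

/-- Exchange the two members of every pair of slots. -/
def flip {n r : ℕ} : Slot n r → Slot n r :=
  Sum.map (fun p => (p.1, !p.2)) id

@[simp] lemma flip_inl {n r : ℕ} (i : Fin n) (b : Bool) :
    flip (Sum.inl (i, b) : Slot n r) = Sum.inl (i, !b) := rfl

@[simp] lemma flip_inr {n r : ℕ} (u : Fin r) : flip (Sum.inr u : Slot n r) = Sum.inr u := rfl

@[simp] lemma flip_flip {n r : ℕ} (j : Slot n r) : flip (flip j) = j := by
  rcases j with ⟨i, b⟩ | u <;> simp

/-- The product of the signs of the differences within the pairs. -/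
def pairSign {n r : ℕ} (x : Slot n r → ℝ) : ℝ :=
  ∏ i : Fin n, Real.sign (x (Sum.inl (i, true)) - x (Sum.inl (i, false)))

/-- Only the relative order of the entries matters, so a strictly increasing family may be replaced
by the indices themselves. -/
lemma pairSign_comp_strictMono {n r N : ℕ} (e : Slot n r ≃ Fin N) {y : Fin N → ℝ}
    (hy : StrictMono y) (σ : Perm (Slot n r)) :
    pairSign ((y ∘ e) ∘ σ) = pairSign (((fun j : Fin N => (j : ℝ)) ∘ e) ∘ σ) := by
  refine Finset.prod_congr rfl fun i _ => ?_
  simp only [Function.comp_apply]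
  generalize e (σ (Sum.inl (i, true))) = a
  generalize e (σ (Sum.inl (i, false))) = b
  rcases lt_trichotomy a b with h | h | h
  · rw [Real.sign_of_neg (sub_neg.2 (hy h)), Real.sign_of_neg]
    simpa using h
  · simp [h]
  · rw [Real.sign_of_pos (sub_pos.2 (hy h)), Real.sign_of_pos]
    simpa using h

/-- The antisymmetrisation of `pairSign`. -/
def antisymPairSign {n r : ℕ} (x : Slot n r → ℝ) : ℝ :=
  ∑ σ : Perm (Slot n r), ((Perm.sign σ : ℤ) : ℝ) * pairSign (x ∘ σ)

lemma antisymPairSign_comp_perm {n r : ℕ} (x : Slot n r → ℝ) (τ : Perm (Slot n r)) :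
    antisymPairSign (x ∘ τ) = ((Perm.sign τ : ℤ) : ℝ) * antisymPairSign x := by
  unfold antisymPairSign
  rw [Finset.mul_sum]
  refine Fintype.sum_equiv (Equiv.mulLeft τ) _ _ fun σ => ?_
  have h : ((Perm.sign τ : ℤ) : ℝ) * ((Perm.sign τ : ℤ) : ℝ) = 1 := by
    rcases Int.units_eq_one_or (Perm.sign τ) with h | h <;> simp [h]
  simp only [Equiv.coe_mulLeft, Perm.sign_mul, Units.val_mul, Int.cast_mul]
  rw [← mul_assoc, ← mul_assoc, h, one_mul]
  rfl

/-- Both sides are alternating and depend only on the order of the entries, so sorting `x` reduces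
the claim to the increasing case. This is what lets a product over all pairs of angles be traded for
a product over n disjoint pairs. -/
lemma antisymPairSign_comp_equiv {n r N : ℕ} (e : Slot n r ≃ Fin N) (x : Fin N → ℝ) :
    antisymPairSign (x ∘ e) =
      antisymPairSign ((fun j : Fin N => (j : ℝ)) ∘ e) * ordSign x := by
  by_cases hx : Function.Injective x
  · set τ := Tuple.sort x
    have hy : StrictMono (x ∘ τ) :=
      (Tuple.monotone_sort x).strictMono_of_injective (hx.comp τ.injective)
    have h1 : antisymPairSign ((x ∘ τ) ∘ e) =
        antisymPairSign ((fun j : Fin N => (j : ℝ)) ∘ e) :=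
      Finset.sum_congr rfl fun σ _ => by rw [pairSign_comp_strictMono e hy σ]
    have h2 : (x ∘ τ) ∘ e = (x ∘ e) ∘ (e.symm.permCongr τ) := by
      funext j; simp [Equiv.permCongr_apply]
    rw [h2, antisymPairSign_comp_perm, Perm.sign_permCongr] at h1
    have h3 := ordSign_of_strictMono hy
    rw [ordSign_comp_perm] at h3
    have h : ((Perm.sign τ : ℤ) : ℝ) * ((Perm.sign τ : ℤ) : ℝ) = 1 := by
      rcases Int.units_eq_one_or (Perm.sign τ) with h | h <;> simp [h]
    have h4 : ordSign x = ((Perm.sign τ : ℤ) : ℝ) := by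
      rw [← mul_one ((Perm.sign τ : ℤ) : ℝ), ← h3, ← mul_assoc, h, one_mul]
    rw [h4, ← h1, mul_right_comm, h, one_mul]
  -- With a repeated entry, swapping the two equal entries changes nothing but negates both
  -- alternating functions, so both vanish.
  · obtain ⟨a, b, hab, hne⟩ : ∃ a b, x a = x b ∧ a ≠ b := by
      simpa [Function.Injective] using hx
    have hs : x ∘ Equiv.swap a b = x := by
      funext j
      rcases eq_or_ne j a with rfl | ha
      · simp [hab]
      · rcases eq_or_ne j b with rfl | hb
        · simp [hab]
        · simp [Equiv.swap_apply_of_ne_of_ne ha hb]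
    have h1 := ordSign_comp_perm x (Equiv.swap a b)
    have h2 := antisymPairSign_comp_perm (x ∘ e) (e.symm.permCongr (Equiv.swap a b))
    have h3 : (x ∘ e) ∘ (e.symm.permCongr (Equiv.swap a b)) = (x ∘ Equiv.swap a b) ∘ e := by
      funext j; simp [Equiv.permCongr_apply]
    rw [h3, Perm.sign_permCongr, hs, Perm.sign_swap hne] at h2
    rw [hs, Perm.sign_swap hne] at h1
    simp only [Units.val_neg, Units.val_one, Int.cast_neg, Int.cast_one, neg_mul, one_mul] at h1 h2
    rw [show antisymPairSign (x ∘ e) = 0 by linarith, show ordSign x = 0 by linarith, mul_zero]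

/-! ### Permutations commuting with the flip, and Pfaffian sums -/

/-- Such a σ is a permutation τ of the pairs followed by swaps inside some of them. Moving whole
pairs is even, since τ acts once on each member, and every internal swap contributes a -1 that the
antisymmetry of `w` compensates. -/
lemma sign_mul_prod_of_comm_flip {n : ℕ} {R : Type*} [CommRing R] (w : Fin n × Bool → R)
    (hw : ∀ i, w (i, false) = -w (i, true)) (σ : Perm (Fin n × Bool))
    (hσ : ∀ i, σ (i, false) = ((σ (i, true)).1, !(σ (i, true)).2)) :
    ((Perm.sign σ : ℤ) : R) * ∏ i, w (σ (i, true)) = ∏ i, w (i, true) := by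
  have hinj : Function.Injective fun i => (σ (i, true)).1 := by
    intro i j hij
    dsimp only at hij
    by_cases h : (σ (i, true)).2 = (σ (j, true)).2
    · exact congrArg Prod.fst (σ.injective (Prod.ext hij h))
    · have : σ (i, false) = σ (j, true) := by
        rw [hσ]
        refine Prod.ext hij ?_
        simpa using Bool.not_eq.2 (Ne.symm h) |>.symm
      simpa using σ.injective this
  set τ : Perm (Fin n) := Equiv.ofBijective _ (Finite.injective_iff_bijective.1 hinj) with hτ
  set d : Fin n → Perm Bool := fun i => if (σ (i, true)).2 then 1 else Equiv.boolNot with hd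
  have key : σ = prodCongrLeft (fun _ : Bool => τ) * prodCongrRight d := by
    ext1 ⟨i, b⟩
    simp only [Perm.mul_apply, prodCongrRight_apply, prodCongrLeft_apply]
    have h1 : τ i = (σ (i, true)).1 := rfl
    cases h : (σ (i, true)).2
    · have h2 : d i = Equiv.boolNot := if_neg (by simp [h])
      cases b
      · rw [hσ, h1, h2, h]; rfl
      · rw [h1, h2]; exact Prod.ext rfl h
    · have h2 : d i = 1 := if_pos h
      cases b
      · rw [hσ, h1, h2, h]; rfl
      · rw [h1, h2]; exact Prod.ext rfl h
  have hsign : Perm.sign σ = ∏ i, Perm.sign (d i) := by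
    conv_lhs => rw [key]
    rw [Perm.sign_mul, Perm.sign_prodCongrLeft, Perm.sign_prodCongrRight]
    simp
  have hnot : Perm.sign Equiv.boolNot = -1 := by decide
  rw [hsign]
  have h2 : ∏ i, w (i, true) = ∏ i, w (τ i, true) :=
    (Equiv.prod_comp τ fun i => w (i, true)).symm
  rw [h2]
  push_cast
  rw [← Finset.prod_mul_distrib]
  refine Finset.prod_congr rfl fun i _ => ?_
  have h3 : σ (i, true) = (τ i, (σ (i, true)).2) := rfl
  cases h : (σ (i, true)).2
  · rw [h3, h, hw]; simp [hd, h, hnot]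
  · rw [h3, h]; simp [hd, h]

lemma sign_mul_prod_of_comm_flip_slot {n r : ℕ} {R : Type*} [CommRing R] (hr : r ≤ 1)
    (w : Slot n r → R) (hw : ∀ i, w (Sum.inl (i, false)) = -w (Sum.inl (i, true)))
    (σ : Perm (Slot n r)) (hσ : ∀ j, σ (flip j) = flip (σ j)) :
    ((Perm.sign σ : ℤ) : R) * ∏ i, w (σ (Sum.inl (i, true))) = ∏ i, w (Sum.inl (i, true)) := by
  -- The single slots are the fixed points of `flip`, so σ preserves them; as there is at most one,
  -- σ acts trivially there.
  have hmaps : Set.MapsTo σ (Set.range Sum.inr) (Set.range Sum.inr) := by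
    rintro _ ⟨u, rfl⟩
    have := hσ (Sum.inr u)
    rcases h : σ (Sum.inr u) with ⟨i, b⟩ | v
    · simp [h] at this
    · exact ⟨v, rfl⟩
  have hmaps' := (Perm.perm_mapsTo_inl_iff_mapsTo_inr σ).2 hmaps
  obtain ⟨⟨σ₁, σ₂⟩, hσ₁₂⟩ := Perm.mem_sumCongrHom_range_of_perm_mapsTo_inl hmaps'
  have : Subsingleton (Fin r) := Fin.subsingleton_iff_le_one.2 hr
  have h2 : σ₂ = 1 := Subsingleton.elim _ _
  subst h2
  have hσ' : σ = Perm.sumCongr σ₁ 1 := hσ₁₂.symm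
  subst hσ'
  rw [Perm.sign_sumCongr, Perm.sign_one, mul_one]
  have := sign_mul_prod_of_comm_flip (fun p => w (Sum.inl p)) hw σ₁ (fun i => by
    have := hσ (Sum.inl (i, true))
    simpa [flip] using this)
  simpa using this

/-- The Pfaffian-type sum of a pairing `h`, with `l` for the single slots. -/
def pfSum {n r : ℕ} (h : Slot n r → Slot n r → ℂ) (l : Slot n r → ℂ) : ℂ :=
  ∑ σ : Perm (Slot n r), ((Perm.sign σ : ℤ) : ℂ) *
    ((∏ i, h (σ (Sum.inl (i, false))) (σ (Sum.inl (i, true)))) * ∏ u, l (σ (Sum.inr u)))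

/-- The number of permutations of the slots that commute with `flip`. -/
def flipCommCard (n r : ℕ) : ℕ :=
  Nat.card {σ : Perm (Slot n r) // ∀ j, σ (flip j) = flip (σ j)}

lemma flipCommCard_ne_zero (n r : ℕ) : flipCommCard n r ≠ 0 := by
  have : Nonempty {σ : Perm (Slot n r) // ∀ j, σ (flip j) = flip (σ j)} := ⟨⟨1, fun _ => rfl⟩⟩
  exact Nat.card_pos.ne'

/-- Only permutations in the centraliser of `flip` survive, and each of them contributes the same
signed product. -/
lemma pfSum_of_antidiagonal {n r : ℕ} (hr : r ≤ 1) (h : Slot n r → Slot n r → ℂ)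
    (l : Slot n r → ℂ) (w : Slot n r → ℂ)
    (hw : ∀ i, w (Sum.inl (i, false)) = -w (Sum.inl (i, true)))
    (hcomm : ∀ σ : Perm (Slot n r), (∀ j, σ (flip j) = flip (σ j)) →
      (∏ i, h (σ (Sum.inl (i, false))) (σ (Sum.inl (i, true)))) * ∏ u, l (σ (Sum.inr u)) =
        ∏ i, w (σ (Sum.inl (i, true))))
    (hncomm : ∀ σ : Perm (Slot n r), (¬ ∀ j, σ (flip j) = flip (σ j)) →
      (∏ i, h (σ (Sum.inl (i, false))) (σ (Sum.inl (i, true)))) * ∏ u, l (σ (Sum.inr u)) = 0) :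
    pfSum h l = flipCommCard n r * ∏ i, w (Sum.inl (i, true)) := by
  classical
  unfold pfSum flipCommCard
  rw [Nat.card_eq_fintype_card, Fintype.card_subtype, ← nsmul_eq_mul, ← Finset.sum_const,
    Finset.sum_filter]
  refine Finset.sum_congr rfl fun σ _ => ?_
  split_ifs with hσ
  · rw [hcomm σ hσ]
    exact sign_mul_prod_of_comm_flip_slot hr w hw σ hσ
  · rw [hncomm σ hσ, mul_zero]

/-! ### Exponentials on (0, 2π] and their pairings -/

/-- The representative in `(0, 2π]` of an angle. -/
def rep (x : Angle) : ℝ := (AddCircle.equivIoc (2 * π) 0 x : ℝ)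

lemma measurable_rep : Measurable rep :=
  measurable_subtype_coe.comp (AddCircle.measurableEquivIoc (2 * π) 0).measurable

lemma rep_pos (x : Angle) : 0 < rep x := (AddCircle.equivIoc (2 * π) 0 x).2.1

lemma rep_le (x : Angle) : rep x ≤ 2 * π :=
  (AddCircle.equivIoc (2 * π) 0 x).2.2.trans_eq (zero_add _)

lemma coe_rep (x : Angle) : ((rep x : ℝ) : Angle) = x :=
  (AddCircle.equivIoc (2 * π) 0).left_inv x

lemma rep_coe {x : ℝ} (h0 : 0 < x) (h1 : x ≤ 2 * π) : rep (x : Angle) = x := by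
  unfold rep
  rw [AddCircle.equivIoc_coe_eq ⟨h0, by simpa using h1⟩]

/-- The function `e^{iqθ}` of `θ ∈ (0, 2π]`. -/
def wave (q : ℝ) (x : Angle) : ℂ := Complex.exp (Complex.I * q * rep x)

lemma measurable_wave (q : ℝ) : Measurable (wave q) :=
  Complex.measurable_exp.comp ((Complex.measurable_ofReal.comp measurable_rep).const_mul _)

lemma norm_wave (q : ℝ) (x : Angle) : ‖wave q x‖ = 1 := by
  rw [wave, Complex.norm_exp]; simp

lemma wave_add (p q : ℝ) (x : Angle) : wave (p + q) x = wave p x * wave q x := by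
  rw [wave, wave, wave, ← Complex.exp_add]; push_cast; ring_nf

lemma wave_zero (x : Angle) : wave 0 x = 1 := by simp [wave]

lemma coe_toCircle (x : Angle) : (x.toCircle : ℂ) = wave 1 x := by
  conv_lhs => rw [← coe_rep x]
  rw [AddCircle.toCircle_apply_mk, Circle.coe_exp, wave]
  congr 1
  push_cast
  field_simp

lemma integral_haar (f : Angle → ℂ) :
    ∫ x, f x ∂AddCircle.haarAddCircle = (2 * π : ℂ)⁻¹ * ∫ t in (0 : ℝ)..2 * π, f (t : Angle) := by
  rw [AddCircle.integral_haarAddCircle, ← AddCircle.intervalIntegral_preimage (2 * π) 0, zero_add,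
    Complex.real_smul]
  push_cast; rfl

lemma integral_haar_rep (f : ℝ → ℂ) :
    ∫ x, f (rep x) ∂AddCircle.haarAddCircle = (2 * π : ℂ)⁻¹ * ∫ t in (0 : ℝ)..2 * π, f t := by
  rw [integral_haar]
  congr 1
  refine intervalIntegral.integral_congr_uIoo fun t ht => ?_
  rw [Set.uIoo_of_le Real.two_pi_pos.le] at ht
  rw [rep_coe ht.1 ht.2.le]

lemma integral_exp_interval (q : ℝ) (hq : q ≠ 0) (a b : ℝ) :
    ∫ t in a..b, Complex.exp (Complex.I * q * (t : ℝ)) =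
      (Complex.exp (Complex.I * q * b) - Complex.exp (Complex.I * q * a)) / (Complex.I * q) :=
  integral_exp_mul_complex (mul_ne_zero Complex.I_ne_zero (Complex.ofReal_ne_zero.2 hq))

lemma integral_wave (q : ℝ) (hq : q ≠ 0) :
    ∫ x, wave q x ∂AddCircle.haarAddCircle =
      (Complex.exp (Complex.I * q * (2 * π)) - 1) / (2 * π * (Complex.I * q)) := by
  unfold wave
  rw [integral_haar_rep fun t => Complex.exp (Complex.I * q * t), integral_exp_interval q hq]
  push_cast
  simp only [mul_zero, Complex.exp_zero]
  rw [inv_mul_eq_div, div_div, mul_comm (2 * (π : ℂ))]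

lemma integral_sign_mul_wave (q : ℝ) (hq : q ≠ 0) (x : Angle) :
    ∫ y, ((Real.sign (rep y - rep x) : ℝ) : ℂ) * wave q y ∂AddCircle.haarAddCircle =
      (Complex.exp (Complex.I * q * (2 * π)) + 1 - 2 * wave q x) / (2 * π * (Complex.I * q)) := by
  unfold wave
  rw [integral_haar_rep fun t =>
    ((Real.sign (t - rep x) : ℝ) : ℂ) * Complex.exp (Complex.I * q * t)]
  have hint : ∀ a b, IntervalIntegrable
      (fun t : ℝ => Complex.exp (Complex.I * q * t)) volume a b :=
    fun a b => Continuous.intervalIntegrable (by fun_prop) a b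
  have e1 : Set.EqOn (fun t : ℝ => -Complex.exp (Complex.I * q * t))
      (fun t => ((Real.sign (t - rep x) : ℝ) : ℂ) * Complex.exp (Complex.I * q * t))
      (Set.Ioo 0 (rep x)) := fun t ht => by
    dsimp only
    rw [Real.sign_of_neg (sub_neg.2 ht.2)]; simp
  have e2 : Set.EqOn (fun t : ℝ => Complex.exp (Complex.I * q * t))
      (fun t => ((Real.sign (t - rep x) : ℝ) : ℂ) * Complex.exp (Complex.I * q * t))
      (Set.Ioo (rep x) (2 * π)) := fun t ht => by
    dsimp only
    rw [Real.sign_of_pos (sub_pos.2 ht.1)]; simp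
  have e1' := e1
  have e2' := e2
  rw [← Set.uIoo_of_le (rep_pos x).le] at e1'
  rw [← Set.uIoo_of_le (rep_le x)] at e2'
  rw [← intervalIntegral.integral_add_adjacent_intervals (b := rep x)
    ((hint 0 (rep x)).neg.congr_uIoo e1') ((hint (rep x) (2 * π)).congr_uIoo e2'),
    ← intervalIntegral.integral_congr_Ioo_of_le (rep_pos x).le e1,
    ← intervalIntegral.integral_congr_Ioo_of_le (rep_le x) e2,
    intervalIntegral.integral_neg, integral_exp_interval q hq, integral_exp_interval q hq]
  push_cast
  have : (q : ℂ) ≠ 0 := Complex.ofReal_ne_zero.2 hq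
  have hI := Complex.I_ne_zero
  have hpi : (π : ℂ) ≠ 0 := Complex.ofReal_ne_zero.2 Real.pi_ne_zero
  simp only [mul_zero, Complex.exp_zero]
  field_simp
  ring

/-- The pairing `∫∫ sgn(y - x) e^{ipx} e^{iqy}`. -/
def pairInt (p q : ℝ) : ℂ :=
  ∫ z : Angle × Angle, ((Real.sign (rep z.2 - rep z.1) : ℝ) : ℂ) * (wave p z.1 * wave q z.2)
    ∂(AddCircle.haarAddCircle.prod AddCircle.haarAddCircle)

/-- The integral of `e^{iqx}`. -/
def singleInt (q : ℝ) : ℂ := ∫ x, wave q x ∂AddCircle.haarAddCircle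

lemma singleInt_zero : singleInt 0 = 1 := by
  simp [singleInt, wave_zero]

lemma exp_int_mul_two_pi_I (z : ℤ) : Complex.exp (Complex.I * z * (2 * π)) = 1 := by
  rw [show Complex.I * z * (2 * π) = z * (2 * π * Complex.I) by ring,
    Complex.exp_int_mul_two_pi_mul_I]

lemma singleInt_intCast {q : ℝ} {z : ℤ} (hz : q = z) (hq : q ≠ 0) : singleInt q = 0 := by
  rw [singleInt, integral_wave q hq, hz]
  have := exp_int_mul_two_pi_I z
  push_cast
  rw [this]; simp

lemma measurable_realSign : Measurable Real.sign := by
  unfold Real.sign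
  exact Measurable.ite measurableSet_Iio measurable_const
    (Measurable.ite measurableSet_Ioi measurable_const measurable_const)

lemma abs_realSign_le (x : ℝ) : |Real.sign x| ≤ 1 := by
  rcases Real.sign_apply_eq x with h | h | h <;> simp [h]

lemma pairInt_eq_iterated (p q : ℝ) :
    pairInt p q = ∫ x, wave p x * (∫ y, ((Real.sign (rep y - rep x) : ℝ) : ℂ) * wave q y
      ∂AddCircle.haarAddCircle) ∂AddCircle.haarAddCircle := by
  unfold pairInt
  rw [integral_prod]
  · refine integral_congr_ae (Filter.Eventually.of_forall fun x => ?_)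
    dsimp only
    rw [← integral_const_mul]
    refine integral_congr_ae (Filter.Eventually.of_forall fun y => ?_)
    dsimp only; ring
  · refine Integrable.of_bound (C := 1) ?_ (Filter.Eventually.of_forall fun z => ?_)
    · refine Measurable.aestronglyMeasurable ?_
      refine (Complex.measurable_ofReal.comp (measurable_realSign.comp
        ((measurable_rep.comp measurable_snd).sub (measurable_rep.comp measurable_fst)))).mul
        (((measurable_wave p).comp measurable_fst).mul ((measurable_wave q).comp measurable_snd))
    · rw [norm_mul, norm_mul, norm_wave, norm_wave, Complex.norm_real, Real.norm_eq_abs]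
      simpa using abs_realSign_le _

/-- For nonzero exponents in a common coset of `ℤ` in `ℤ / 2`, the pairing is antidiagonal. -/
lemma pairInt_eq {p q : ℝ} (hp : p ≠ 0) (hq : q ≠ 0) {m z w : ℤ} (hpz : p = z - m / 2)
    (hqw : q = w - m / 2) :
    pairInt p q = if p + q = 0 then Complex.I / (π * q) else 0 := by
  have hq' : (q : ℂ) ≠ 0 := Complex.ofReal_ne_zero.2 hq
  have hpi : (π : ℂ) ≠ 0 := Complex.ofReal_ne_zero.2 Real.pi_ne_zero
  have hI := Complex.I_ne_zero
  have hint : ∀ r, Integrable (wave r) AddCircle.haarAddCircle := fun r =>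
    Integrable.of_bound (C := 1) (measurable_wave r).aestronglyMeasurable
      (Filter.Eventually.of_forall fun x => (norm_wave r x).le)
  -- The boundary term dies for either parity of m: an integer p ≠ 0 integrates to zero, and a
  -- half-integer q has e^{2πiq} = -1.
  have hvanish : singleInt p * (Complex.exp (Complex.I * q * (2 * π)) + 1) = 0 := by
    obtain ⟨c, rfl | rfl⟩ := Int.even_or_odd' m
    · rw [singleInt_intCast (z := z - c) (by rw [hpz]; push_cast; ring) hp, zero_mul]
    · have : Complex.exp (Complex.I * q * (2 * π)) = -1 := by
        rw [show Complex.I * q * (2 * π) = Complex.I * ((w - c - 1 : ℤ) : ℂ) * (2 * π) +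
          π * Complex.I by rw [hqw]; push_cast; ring, Complex.exp_add, exp_int_mul_two_pi_I,
          Complex.exp_pi_mul_I, one_mul]
      rw [this]; simp
  have hsum : singleInt (p + q) = if p + q = 0 then 1 else 0 := by
    split_ifs with h
    · rw [h, singleInt_zero]
    · exact singleInt_intCast (z := z + w - m) (by rw [hpz, hqw]; push_cast; ring) h
  have : pairInt p q = (singleInt p * (Complex.exp (Complex.I * q * (2 * π)) + 1) -
      2 * singleInt (p + q)) / (2 * π * (Complex.I * q)) := by
    rw [pairInt_eq_iterated]
    simp only [integral_sign_mul_wave q hq]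
    unfold singleInt
    rw [← integral_mul_const, ← integral_const_mul, ← integral_sub
      ((hint p).mul_const _) ((hint (p + q)).const_mul _), ← integral_div]
    refine integral_congr_ae (Filter.Eventually.of_forall fun x => ?_)
    dsimp only
    rw [wave_add]; ring
  rw [this, hvanish, hsum]
  split_ifs
  · field_simp
    rw [Complex.I_sq]; ring
  · simp

/-! ### Integrals of determinants against the ordering sign -/

/-- Regroup the coordinates of a product space into pairs and single coordinates. -/
lemma exists_measurePreserving_pairs {n r N : ℕ} (e : Slot n r ≃ Fin N) {A : Type}
    [MeasurableSpace A] (μ : Measure A) [SigmaFinite μ] :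
    ∃ Φ : ((Fin n → A × A) × (Fin r → A)) ≃ᵐ (Fin N → A),
      MeasurePreserving Φ ((Measure.pi fun _ => μ.prod μ).prod (Measure.pi fun _ => μ))
        (Measure.pi fun _ => μ) ∧
      ∀ z, (∀ i, Φ z (e (Sum.inl (i, false))) = (z.1 i).1) ∧
        (∀ i, Φ z (e (Sum.inl (i, true))) = (z.1 i).2) ∧
        ∀ u, Φ z (e (Sum.inr u)) = z.2 u := by
  let c : (Fin n ⊕ Fin n) ⊕ Fin r ≃ Fin N :=
    (Equiv.sumCongr ((Equiv.boolProdEquivSum (Fin n)).symm.trans (Equiv.prodComm _ _))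
      (Equiv.refl _)).trans e
  let Φ₁ : ((Fin n → A × A) × (Fin r → A)) ≃ᵐ ((Fin n → A) × (Fin n → A)) × (Fin r → A) :=
    MeasurableEquiv.prodCongr (MeasurableEquiv.arrowProdEquivProdArrow A A (Fin n))
      (MeasurableEquiv.refl _)
  let Φ₂ : (((Fin n → A) × (Fin n → A)) × (Fin r → A)) ≃ᵐ (Fin n ⊕ Fin n → A) × (Fin r → A) :=
    MeasurableEquiv.prodCongr (MeasurableEquiv.sumPiEquivProdPi fun _ => A).symm
      (MeasurableEquiv.refl _)
  let Φ₃ : ((Fin n ⊕ Fin n → A) × (Fin r → A)) ≃ᵐ ((Fin n ⊕ Fin n) ⊕ Fin r → A) :=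
    (MeasurableEquiv.sumPiEquivProdPi fun _ => A).symm
  let Φ₄ : ((Fin n ⊕ Fin n) ⊕ Fin r → A) ≃ᵐ (Fin N → A) :=
    MeasurableEquiv.piCongrLeft (fun _ => A) c
  have h₁ : MeasurePreserving Φ₁ ((Measure.pi fun _ => μ.prod μ).prod (Measure.pi fun _ => μ))
      (((Measure.pi fun _ => μ).prod (Measure.pi fun _ => μ)).prod (Measure.pi fun _ => μ)) :=
    (measurePreserving_arrowProdEquivProdArrow A A (Fin n) (fun _ => μ) (fun _ => μ)).prod
      (MeasurePreserving.id _)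
  have h₂ : MeasurePreserving Φ₂
      (((Measure.pi fun _ => μ).prod (Measure.pi fun _ => μ)).prod (Measure.pi fun _ => μ))
      ((Measure.pi fun _ => μ).prod (Measure.pi fun _ => μ)) :=
    (measurePreserving_sumPiEquivProdPi_symm fun _ => μ).prod (MeasurePreserving.id _)
  have h₃ : MeasurePreserving Φ₃ ((Measure.pi fun _ => μ).prod (Measure.pi fun _ => μ))
      (Measure.pi fun _ => μ) := measurePreserving_sumPiEquivProdPi_symm fun _ => μ
  have h₄ : MeasurePreserving Φ₄ (Measure.pi fun _ => μ) (Measure.pi fun _ => μ) :=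
    measurePreserving_piCongrLeft (fun _ => μ) c
  refine ⟨((Φ₁.trans Φ₂).trans Φ₃).trans Φ₄, ((h₁.trans h₂).trans h₃).trans h₄, fun z => ?_⟩
  have key : ∀ s, Φ₄ (Φ₃ (Φ₂ (Φ₁ z))) (c s) = Φ₃ (Φ₂ (Φ₁ z)) s := fun s =>
    Equiv.piCongrLeft_apply_apply (fun _ => A) c _ s
  exact ⟨fun i => key (Sum.inl (Sum.inl i)), fun i => key (Sum.inl (Sum.inr i)),
    fun u => key (Sum.inr u)⟩

lemma integral_pairs {n r N : ℕ} (e : Slot n r ≃ Fin N) {A : Type} [MeasurableSpace A]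
    (μ : Measure A) [SigmaFinite μ] (g : Fin n → A → A → ℂ) (l : Fin r → A → ℂ) :
    ∫ θ : Fin N → A, (∏ i, g i (θ (e (Sum.inl (i, false)))) (θ (e (Sum.inl (i, true))))) *
      ∏ u, l u (θ (e (Sum.inr u))) ∂(Measure.pi fun _ => μ) =
    (∏ i, ∫ z : A × A, g i z.1 z.2 ∂(μ.prod μ)) * ∏ u, ∫ x, l u x ∂μ := by
  obtain ⟨Φ, hΦ, hz⟩ := exists_measurePreserving_pairs e μ
  rw [← hΦ.integral_comp']
  simp only [(hz _).1, (hz _).2.1, (hz _).2.2]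
  rw [integral_prod_mul (fun x : Fin n → A × A => ∏ i, g i (x i).1 (x i).2)
    (fun y : Fin r → A => ∏ u, l u (y u)),
    integral_fintype_prod_eq_prod (fun i (z : A × A) => g i z.1 z.2),
    integral_fintype_prod_eq_prod (fun u (x : A) => l u x)]

instance (N : ℕ) : IsProbabilityMeasure (torusMeasure N) := by
  unfold torusMeasure; infer_instance

/-- Permute the angles. -/
def permEquiv {N : ℕ} (σ : Perm (Fin N)) : (Fin N → Angle) ≃ᵐ (Fin N → Angle) :=
  MeasurableEquiv.piCongrLeft (fun _ : Fin N => Angle) σ.symm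

lemma permEquiv_apply {N : ℕ} (σ : Perm (Fin N)) (θ : Fin N → Angle) :
    permEquiv σ θ = θ ∘ σ := by
  funext a
  have := Equiv.piCongrLeft_apply_apply (fun _ : Fin N => Angle) σ.symm θ (σ a)
  rw [Equiv.symm_apply_apply] at this
  exact this

lemma measurePreserving_permEquiv {N : ℕ} (σ : Perm (Fin N)) :
    MeasurePreserving (permEquiv σ) (torusMeasure N) (torusMeasure N) :=
  measurePreserving_piCongrLeft (fun _ => AddCircle.haarAddCircle) σ.symm

lemma measurePreserving_comp_perm {N : ℕ} (σ : Perm (Fin N)) :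
    MeasurePreserving (fun θ : Fin N → Angle => θ ∘ σ) (torusMeasure N) (torusMeasure N) := by
  have h := measurePreserving_permEquiv σ
  rwa [show (permEquiv σ : (Fin N → Angle) → (Fin N → Angle)) = fun θ => θ ∘ σ from
    funext (permEquiv_apply σ)] at h

lemma integral_comp_perm {N : ℕ} (σ : Perm (Fin N)) (f : (Fin N → Angle) → ℂ) :
    ∫ θ, f (θ ∘ σ) ∂torusMeasure N = ∫ θ, f θ ∂torusMeasure N := by
  have := (measurePreserving_permEquiv σ).integral_comp' f
  simpa only [permEquiv_apply] using this

/-- The determinant of the functions `e^{iq_aθ}` at the angles `θ_j`. -/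
def detWave {N : ℕ} (q : Fin N → ℝ) (θ : Fin N → Angle) : ℂ :=
  (Matrix.of fun j a => wave (q a) (θ j)).det

/-- The integral of `e^{iq_aθ_j}` determinants against the sign of the ordering. -/
def signedInt {N : ℕ} (q : Fin N → ℝ) : ℂ :=
  ∫ θ, (ordSign (rep ∘ θ) : ℂ) * detWave q θ ∂torusMeasure N

lemma measurable_detWave {N : ℕ} (q : Fin N → ℝ) : Measurable (detWave q) := by
  unfold detWave
  simp only [Matrix.det_apply', Matrix.of_apply]
  exact Finset.measurable_fun_sum _ fun σ _ => (Finset.measurable_fun_prod _ fun j _ =>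
    (measurable_wave (q j)).comp (measurable_pi_apply (σ j))).const_mul _

lemma norm_detWave_le {N : ℕ} (q : Fin N → ℝ) (θ : Fin N → Angle) :
    ‖detWave q θ‖ ≤ N.factorial := by
  unfold detWave
  rw [Matrix.det_apply]
  refine (norm_sum_le _ _).trans ?_
  have : ∀ σ ∈ (Finset.univ : Finset (Perm (Fin N))),
      ‖Perm.sign σ • ∏ i, (Matrix.of fun j a => wave (q a) (θ j)) (σ i) i‖ ≤ 1 := fun σ _ => by
    rcases Int.units_eq_one_or (Perm.sign σ) with h | h <;> simp [h, norm_wave]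
  refine (Finset.sum_le_sum this).trans ?_
  simp [Fintype.card_perm]

lemma measurable_ordSign_rep {N : ℕ} :
    Measurable fun θ : Fin N → Angle => ordSign (rep ∘ θ) := by
  unfold ordSign
  refine Finset.measurable_fun_prod _ fun j _ => Finset.measurable_fun_prod _ fun k _ => ?_
  exact measurable_realSign.comp ((measurable_rep.comp (measurable_pi_apply k)).sub
    (measurable_rep.comp (measurable_pi_apply j)))

lemma abs_ordSign_le {N : ℕ} (x : Fin N → ℝ) : |ordSign x| ≤ 1 := by
  unfold ordSign
  simp only [Finset.abs_prod]
  exact Finset.prod_le_one (fun _ _ => Finset.prod_nonneg fun _ _ => abs_nonneg _)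
    fun _ _ => Finset.prod_le_one (fun _ _ => abs_nonneg _) fun _ _ => abs_realSign_le _

lemma integrable_ordSign_mul_detWave {N : ℕ} (q : Fin N → ℝ) :
    Integrable (fun θ => (ordSign (rep ∘ θ) : ℂ) * detWave q θ) (torusMeasure N) := by
  refine Integrable.of_bound (C := 1 * N.factorial)
    ((Complex.measurable_ofReal.comp measurable_ordSign_rep).mul
      (measurable_detWave q)).aestronglyMeasurable (Filter.Eventually.of_forall fun θ => ?_)
  rw [norm_mul, Complex.norm_real, Real.norm_eq_abs]
  exact mul_le_mul (abs_ordSign_le _) (norm_detWave_le _ _) (norm_nonneg _) zero_le_one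

lemma measurable_pairSign_rep {n r N : ℕ} (e : Slot n r ≃ Fin N) :
    Measurable fun θ : Fin N → Angle => pairSign (rep ∘ θ ∘ e) := by
  unfold pairSign
  refine Finset.measurable_fun_prod _ fun i _ => ?_
  exact measurable_realSign.comp
    ((measurable_rep.comp (measurable_pi_apply (e (Sum.inl (i, true))))).sub
      (measurable_rep.comp (measurable_pi_apply (e (Sum.inl (i, false))))))

lemma abs_pairSign_le {n r : ℕ} (x : Slot n r → ℝ) : |pairSign x| ≤ 1 := by
  unfold pairSign
  simp only [Finset.abs_prod]
  exact Finset.prod_le_one (fun _ _ => abs_nonneg _) fun _ _ => abs_realSign_le _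

lemma detWave_comp_perm {N : ℕ} (q : Fin N → ℝ) (θ : Fin N → Angle) (σ : Perm (Fin N)) :
    detWave q (θ ∘ σ) = ((Perm.sign σ : ℤ) : ℂ) * detWave q θ := by
  unfold detWave
  rw [← Matrix.det_permute σ]
  rfl

lemma detWave_perm_comp {N : ℕ} (q : Fin N → ℝ) (θ : Fin N → Angle) (σ : Perm (Fin N)) :
    detWave (q ∘ σ) θ = ((Perm.sign σ : ℤ) : ℂ) * detWave q θ := by
  unfold detWave
  rw [← Matrix.det_permute' σ]
  rfl

lemma signedInt_perm_comp {N : ℕ} (q : Fin N → ℝ) (σ : Perm (Fin N)) :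
    signedInt (q ∘ σ) = ((Perm.sign σ : ℤ) : ℂ) * signedInt q := by
  unfold signedInt
  simp only [detWave_perm_comp]
  rw [← integral_const_mul]
  congr 1; funext θ; ring

lemma signedInt_eq_zero_of_not_injective {N : ℕ} {q : Fin N → ℝ} (hq : ¬ Function.Injective q) :
    signedInt q = 0 := by
  obtain ⟨a, b, hab, hne⟩ : ∃ a b, q a = q b ∧ a ≠ b := by
    simpa [Function.Injective] using hq
  have : ∀ θ, detWave q θ = 0 := fun θ =>
    Matrix.det_zero_of_column_eq hne fun j => by simp [hab]
  simp [signedInt, this]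

lemma detWave_eq_sum {n r N : ℕ} (e : Slot n r ≃ Fin N) (q : Fin N → ℝ) (θ : Fin N → Angle) :
    detWave q θ = ∑ σ : Perm (Slot n r), ((Perm.sign σ : ℤ) : ℂ) *
      ((∏ i, wave (q (e (σ (Sum.inl (i, false))))) (θ (e (Sum.inl (i, false)))) *
        wave (q (e (σ (Sum.inl (i, true))))) (θ (e (Sum.inl (i, true))))) *
      ∏ u, wave (q (e (σ (Sum.inr u)))) (θ (e (Sum.inr u)))) := by
  unfold detWave
  rw [← Matrix.det_submatrix_equiv_self e, ← Matrix.det_transpose, Matrix.det_apply']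
  refine Finset.sum_congr rfl fun σ _ => ?_
  rw [Fintype.prod_sum_type, Fintype.prod_prod_type]
  congr 2
  refine Finset.prod_congr rfl fun i _ => ?_
  rw [Fintype.prod_bool, mul_comm]
  rfl

lemma integral_pairSign_mul_detWave {n r N : ℕ} (e : Slot n r ≃ Fin N) (q : Fin N → ℝ) :
    ∫ θ, (pairSign (rep ∘ θ ∘ e) : ℂ) * detWave q θ ∂torusMeasure N =
      pfSum (fun a b => pairInt (q (e a)) (q (e b))) (fun a => singleInt (q (e a))) := by
  have hsplit : ∀ θ : Fin N → Angle, (pairSign (rep ∘ θ ∘ e) : ℂ) * detWave q θ =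
      ∑ σ : Perm (Slot n r), ((Perm.sign σ : ℤ) : ℂ) *
      ((∏ i, (((Real.sign (rep (θ (e (Sum.inl (i, true)))) - rep (θ (e (Sum.inl (i, false)))))
          : ℝ) : ℂ) * (wave (q (e (σ (Sum.inl (i, false))))) (θ (e (Sum.inl (i, false)))) *
        wave (q (e (σ (Sum.inl (i, true))))) (θ (e (Sum.inl (i, true))))))) *
      ∏ u, wave (q (e (σ (Sum.inr u)))) (θ (e (Sum.inr u)))) := fun θ => by
    rw [detWave_eq_sum e, Finset.mul_sum]
    refine Finset.sum_congr rfl fun σ _ => ?_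
    rw [Finset.prod_mul_distrib (f := fun i => ((Real.sign _ : ℝ) : ℂ))]
    unfold pairSign
    push_cast
    simp only [Function.comp_apply]
    ring
  simp only [hsplit]
  rw [integral_finsetSum]
  · unfold pfSum
    refine Finset.sum_congr rfl fun σ _ => ?_
    rw [integral_const_mul]
    congr 1
    exact integral_pairs e AddCircle.haarAddCircle
      (fun i x y => ((Real.sign (rep y - rep x) : ℝ) : ℂ) *
        (wave (q (e (σ (Sum.inl (i, false))))) x * wave (q (e (σ (Sum.inl (i, true))))) y))
      (fun u x => wave (q (e (σ (Sum.inr u)))) x)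
  · intro σ _
    refine Integrable.const_mul ?_ _
    refine Integrable.of_bound (C := 1) (Measurable.aestronglyMeasurable ?_)
      (Filter.Eventually.of_forall fun θ => ?_)
    · have hr : ∀ a, Measurable fun θ : Fin N → Angle => rep (θ a) := fun a =>
        measurable_rep.comp (measurable_pi_apply a)
      have hw : ∀ p a, Measurable fun θ : Fin N → Angle => wave p (θ a) := fun p a =>
        (measurable_wave p).comp (measurable_pi_apply a)
      exact (Finset.measurable_fun_prod _ fun i _ => (Complex.measurable_ofReal.comp
        (measurable_realSign.comp ((hr _).sub (hr _)))).mul ((hw _ _).mul (hw _ _))).mul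
        (Finset.measurable_fun_prod _ fun u _ => hw _ _)
    · simp only [norm_mul, norm_prod, norm_wave, Complex.norm_real, Real.norm_eq_abs, mul_one,
        Finset.prod_const_one]
      exact Finset.prod_le_one (fun _ _ => abs_nonneg _) fun _ _ => abs_realSign_le _

/-- The constant relating the antisymmetrised `pairSign` to the sign of the ordering. -/
def antisymConst {n r N : ℕ} (e : Slot n r ≃ Fin N) : ℝ :=
  antisymPairSign ((fun j : Fin N => (j : ℝ)) ∘ e)

/-- De Bruijn's formula. -/
lemma antisymConst_mul_signedInt {n r N : ℕ} (e : Slot n r ≃ Fin N) (q : Fin N → ℝ) :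
    (antisymConst e : ℂ) * signedInt q = (Fintype.card (Perm (Slot n r)) : ℂ) *
      pfSum (fun a b => pairInt (q (e a)) (q (e b))) (fun a => singleInt (q (e a))) := by
  have hint : Integrable (fun θ => (pairSign (rep ∘ θ ∘ e) : ℂ) * detWave q θ)
      (torusMeasure N) := by
    refine Integrable.of_bound (C := 1 * N.factorial)
      ((Complex.measurable_ofReal.comp (measurable_pairSign_rep e)).mul
        (measurable_detWave q)).aestronglyMeasurable (Filter.Eventually.of_forall fun θ => ?_)
    rw [norm_mul, Complex.norm_real, Real.norm_eq_abs]
    exact mul_le_mul (abs_pairSign_le _) (norm_detWave_le _ _) (norm_nonneg _) zero_le_one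
  -- Relabelling the angles by σ multiplies the determinant by the sign of σ, so the sum over
  -- relabellings antisymmetrises `pairSign`. After integration all relabellings contribute equally.
  have hpt : ∀ θ : Fin N → Angle, (antisymConst e : ℂ) *
      ((ordSign (rep ∘ θ) : ℂ) * detWave q θ) = ∑ σ : Perm (Slot n r),
        (pairSign (rep ∘ (θ ∘ e.permCongr σ) ∘ e) : ℂ) * detWave q (θ ∘ e.permCongr σ) := by
    intro θ
    rw [← mul_assoc, ← Complex.ofReal_mul, antisymConst, ← antisymPairSign_comp_equiv,
      antisymPairSign, Complex.ofReal_sum, Finset.sum_mul]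
    refine Finset.sum_congr rfl fun σ _ => ?_
    rw [detWave_comp_perm, Perm.sign_permCongr]
    have : rep ∘ (θ ∘ e.permCongr σ) ∘ e = ((rep ∘ θ) ∘ e) ∘ σ := by
      funext j; simp [Equiv.permCongr_apply]
    rw [this]
    push_cast
    ring
  unfold signedInt
  rw [← integral_const_mul]
  simp only [hpt]
  rw [integral_finsetSum]
  · rw [Finset.sum_congr rfl fun σ _ => integral_comp_perm (e.permCongr σ) fun θ =>
      (pairSign (rep ∘ θ ∘ e) : ℂ) * detWave q θ]
    rw [integral_pairSign_mul_detWave, Finset.sum_const, nsmul_eq_mul]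
    rfl
  · intro σ _
    exact (measurePreserving_comp_perm (e.permCongr σ)).integrable_comp_of_integrable hint

/-! ### Evaluation for exponents symmetric under negation -/

/-- The exponents lie in `ℤ - (N - 1) / 2`. -/
def InCoset {N : ℕ} (q : Fin N → ℝ) : Prop := ∀ a, ∃ z : ℤ, q a = z - ((N - 1 : ℤ) : ℝ) / 2

section Evaluation

variable {n r N : ℕ} (e : Slot n r ≃ Fin N) {q : Fin N → ℝ}

lemma card_eq_of_slot (e : Slot n r ≃ Fin N) : N = n * 2 + r := by
  have := Fintype.card_congr e
  simpa using this.symm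

/-- For even N the exponents are half-integers; for odd N the value 0 is already taken by the single
slot. -/
lemma ne_zero_of_single_eq_zero (hr : r ≤ 1) (hinj : Function.Injective q) (hq : InCoset q)
    (σ : Perm (Slot n r)) (hu : ∀ u, q (e (σ (Sum.inr u))) = 0) (p : Fin n × Bool) :
    q (e (σ (Sum.inl p))) ≠ 0 := by
  intro h0
  have hN := card_eq_of_slot e
  interval_cases r
  · obtain ⟨z, hz⟩ := hq (e (σ (Sum.inl p)))
    rw [h0] at hz
    have : ((2 * z : ℤ) : ℝ) = ((N - 1 : ℤ) : ℝ) := by push_cast at hz ⊢; linarith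
    have := Int.cast_injective this
    omega
  · have := hinj (h0.trans (hu 0).symm)
    simpa using σ.injective (e.injective this)

/-- A single slot exists only for odd N, where exponents are integers and the single integral forces
exponent 0. The paired exponents are then nonzero, and the antidiagonal pairing makes them opposite.
-/
lemma term_ne_zero (hr : r ≤ 1) (hinj : Function.Injective q) (hq : InCoset q)
    (σ : Perm (Slot n r))
    (h : (∏ i, pairInt (q (e (σ (Sum.inl (i, false))))) (q (e (σ (Sum.inl (i, true)))))) *
      ∏ u, singleInt (q (e (σ (Sum.inr u)))) ≠ 0) (j : Slot n r) :
    q (e (σ (flip j))) = -q (e (σ j)) := by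
  have hN := card_eq_of_slot e
  have h1 := Finset.prod_ne_zero_iff.1 (left_ne_zero_of_mul h)
  have h2 := Finset.prod_ne_zero_iff.1 (right_ne_zero_of_mul h)
  have hu : ∀ u, q (e (σ (Sum.inr u))) = 0 := by
    intro u
    by_contra hne
    have hr1 : r = 1 := by have := u.2; omega
    obtain ⟨z, hz⟩ := hq (e (σ (Sum.inr u)))
    refine h2 u (Finset.mem_univ _) (singleInt_intCast (z := z - n) ?_ hne)
    rw [hz, hN, hr1]; push_cast; ring
  have h0 := ne_zero_of_single_eq_zero e hr hinj hq σ hu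
  rcases j with ⟨i, b⟩ | u
  · obtain ⟨z, hz⟩ := hq (e (σ (Sum.inl (i, false))))
    obtain ⟨w, hw⟩ := hq (e (σ (Sum.inl (i, true))))
    have := h1 i (Finset.mem_univ _)
    rw [pairInt_eq (h0 _) (h0 _) hz hw] at this
    have := (ite_ne_right_iff.1 this).1
    cases b <;> simp only [flip_inl, Bool.not_false, Bool.not_true] <;> linarith
  · rw [flip_inr, hu, neg_zero]

lemma term_eq (hr : r ≤ 1) (hinj : Function.Injective q) (hq : InCoset q)
    (σ : Perm (Slot n r)) (h : ∀ j, q (e (σ (flip j))) = -q (e (σ j))) :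
    (∏ i, pairInt (q (e (σ (Sum.inl (i, false))))) (q (e (σ (Sum.inl (i, true)))))) *
      ∏ u, singleInt (q (e (σ (Sum.inr u)))) =
    ∏ i, Complex.I / (π * q (e (σ (Sum.inl (i, true))))) := by
  have hu : ∀ u, q (e (σ (Sum.inr u))) = 0 := fun u => by
    have := h (Sum.inr u)
    rw [flip_inr] at this
    linarith
  have h0 := ne_zero_of_single_eq_zero e hr hinj hq σ hu
  simp only [hu, singleInt_zero, Finset.prod_const_one, mul_one]
  refine Finset.prod_congr rfl fun i _ => ?_
  obtain ⟨z, hz⟩ := hq (e (σ (Sum.inl (i, false))))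
  obtain ⟨w, hw⟩ := hq (e (σ (Sum.inl (i, true))))
  have := h (Sum.inl (i, true))
  rw [flip_inl, Bool.not_true] at this
  rw [pairInt_eq (h0 _) (h0 _) hz hw, if_pos (by linarith)]

lemma antisymConst_mul_signedInt_of_flip (hr : r ≤ 1) (hinj : Function.Injective q)
    (hq : InCoset q) (hflip : ∀ j, q (e (flip j)) = -q (e j)) :
    (antisymConst e : ℂ) * signedInt q = (Fintype.card (Perm (Slot n r)) : ℂ) *
      (flipCommCard n r * ∏ i, Complex.I / (π * q (e (Sum.inl (i, true))))) := by
  rw [antisymConst_mul_signedInt, pfSum_of_antidiagonal hr _ _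
    (fun j => Complex.I / (π * q (e j)))]
  · intro i
    have := hflip (Sum.inl (i, true))
    rw [flip_inl, Bool.not_true] at this
    rw [this]; push_cast; rw [mul_neg, div_neg]
  · intro σ hσ
    exact term_eq e hr hinj hq σ fun j => by rw [hσ, hflip]
  · intro σ hσ
    by_contra hne
    refine hσ fun j => e.injective (hinj ?_)
    rw [term_ne_zero e hr hinj hq σ hne j, hflip]

lemma exists_perm_of_signedInt_ne_zero (hr : r ≤ 1) (hC : antisymConst e ≠ 0)
    (hq : InCoset q) (h : signedInt q ≠ 0) :
    ∃ ρ : Fin N → Fin N, ∀ a, q (ρ a) = -q a := by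
  have hinj : Function.Injective q := by
    by_contra hni
    exact h (signedInt_eq_zero_of_not_injective hni)
  have h1 : (antisymConst e : ℂ) * signedInt q ≠ 0 :=
    mul_ne_zero (Complex.ofReal_ne_zero.2 hC) h
  rw [antisymConst_mul_signedInt] at h1
  obtain ⟨σ, -, hσ⟩ := Finset.exists_ne_zero_of_sum_ne_zero (right_ne_zero_of_mul h1)
  have := term_ne_zero e hr hinj hq σ (right_ne_zero_of_mul hσ)
  refine ⟨fun a => e (σ (flip (σ.symm (e.symm a)))), fun a => ?_⟩
  rw [this]; simp

end Evaluation

/-- The exponents `-(N - 1) / 2, …, (N - 1) / 2`. -/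
def base (N : ℕ) (a : Fin N) : ℝ := (a : ℝ) - ((N : ℝ) - 1) / 2

lemma base_injective (N : ℕ) : Function.Injective (base N) := by
  intro a b h
  unfold base at h
  have : (a : ℝ) = (b : ℝ) := by linarith
  exact Fin.ext (Nat.cast_injective this)

lemma base_rev {N : ℕ} (a : Fin N) : base N a.rev = -base N a := by
  unfold base
  rw [Fin.val_rev, Nat.cast_sub (by omega)]
  push_cast; ring

lemma base_le {N : ℕ} (a : Fin N) : base N a ≤ ((N : ℝ) - 1) / 2 := by
  unfold base
  have : ((a : ℕ) : ℝ) + 1 ≤ N := by exact_mod_cast a.2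
  linarith

lemma neg_le_base {N : ℕ} (a : Fin N) : -(((N : ℝ) - 1) / 2) ≤ base N a := by
  have := base_le a.rev
  rw [base_rev] at this
  linarith

lemma inCoset_base (N : ℕ) : InCoset (base N) := fun a => ⟨a, by unfold base; push_cast; ring⟩

/-- Pair the index `i` with `N - 1 - i`. -/
def slotFun (N : ℕ) : Slot (N / 2) (N % 2) → Fin N
  | Sum.inl (i, false) => ⟨i, by have := i.2; omega⟩
  | Sum.inl (i, true) => ⟨N - 1 - i, by have := i.2; omega⟩
  | Sum.inr u => ⟨N / 2, by have := u.2; omega⟩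

lemma slotFun_injective (N : ℕ) : Function.Injective (slotFun N) := by
  rintro (⟨i, _ | _⟩ | u) (⟨j, _ | _⟩ | v) h <;>
    simp only [slotFun, Fin.mk.injEq] at h
  all_goals first
    | (have := i.2; have := j.2; exfalso; omega)
    | (have := i.2; have := j.2; congr 2; ext; omega)
    | (have := i.2; have := v.2; omega)
    | (have := u.2; have := j.2; omega)
    | (have := u.2; have := v.2; congr 1; ext; omega)

/-- The pairing of the index `i` with `N - 1 - i` as an equivalence. -/
def slotEquiv (N : ℕ) : Slot (N / 2) (N % 2) ≃ Fin N :=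
  Equiv.ofBijective (slotFun N) ((Fintype.bijective_iff_injective_and_card _).2
    ⟨slotFun_injective N, by simp; omega⟩)

lemma slotEquiv_flip (N : ℕ) (j : Slot (N / 2) (N % 2)) :
    slotEquiv N (flip j) = (slotEquiv N j).rev := by
  change slotFun N (flip j) = (slotFun N j).rev
  rcases j with ⟨i, _ | _⟩ | u
  · ext; simp [slotFun]; omega
  · ext; simp [slotFun]; have := i.2; omega
  · ext; simp [slotFun]; have := u.2; omega

lemma mod_two_le_one (N : ℕ) : N % 2 ≤ 1 := by omega

lemma antisymConst_mul_signedInt_of_rev {N : ℕ} {q : Fin N → ℝ} (hinj : Function.Injective q)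
    (hq : InCoset q) (hrev : ∀ a, q a.rev = -q a) :
    (antisymConst (slotEquiv N) : ℂ) * signedInt q =
      (Fintype.card (Perm (Slot (N / 2) (N % 2))) : ℂ) * (flipCommCard (N / 2) (N % 2) *
        ∏ i, Complex.I / (π * q (slotEquiv N (Sum.inl (i, true))))) :=
  antisymConst_mul_signedInt_of_flip (slotEquiv N) (mod_two_le_one N) hinj hq fun j => by
    rw [slotEquiv_flip, hrev]

/-- A nonzero product has nonzero factors: this gives both the nonvanishing of the combinatorial
constant and that of the normalisation without computing either. -/
lemma antisymConst_mul_signedInt_base_ne_zero (N : ℕ) :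
    (antisymConst (slotEquiv N) : ℂ) * signedInt (base N) ≠ 0 := by
  rw [antisymConst_mul_signedInt_of_rev (base_injective N) (inCoset_base N) base_rev]
  refine mul_ne_zero (Nat.cast_ne_zero.2 Fintype.card_ne_zero) (mul_ne_zero
    (Nat.cast_ne_zero.2 (flipCommCard_ne_zero _ _)) (Finset.prod_ne_zero_iff.2 fun i _ => ?_))
  refine div_ne_zero Complex.I_ne_zero (mul_ne_zero (Complex.ofReal_ne_zero.2 Real.pi_ne_zero)
    (Complex.ofReal_ne_zero.2 ?_))
  refine ne_zero_of_single_eq_zero (slotEquiv N) (mod_two_le_one N) (base_injective N)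
    (inCoset_base N) 1 (fun u => ?_) (i, true)
  have h := base_rev (slotEquiv N (Sum.inr u))
  rw [← slotEquiv_flip, flip_inr] at h
  rw [Perm.one_apply]
  linarith

lemma antisymConst_slotEquiv_ne_zero (N : ℕ) : antisymConst (slotEquiv N) ≠ 0 :=
  Complex.ofReal_ne_zero.1 (left_ne_zero_of_mul (antisymConst_mul_signedInt_base_ne_zero N))

lemma signedInt_base_ne_zero (N : ℕ) : signedInt (base N) ≠ 0 :=
  right_ne_zero_of_mul (antisymConst_mul_signedInt_base_ne_zero N)

/-! ### Determinants with two shifted exponents -/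

/-- Raise the exponent of index `a` and lower that of index `b` by `k`. -/
def shift (N k : ℕ) (a b : Fin N) (c : Fin N) : ℝ :=
  base N c + (if c = a then (k : ℝ) else 0) - (if c = b then (k : ℝ) else 0)

section Shift

variable {N k : ℕ} {a b : Fin N}

lemma shift_left (hab : a ≠ b) : shift N k a b a = base N a + k := by simp [shift, hab]

lemma shift_right (hab : a ≠ b) : shift N k a b b = base N b - k := by simp [shift, hab.symm]

lemma shift_of_ne {c : Fin N} (ha : c ≠ a) (hb : c ≠ b) : shift N k a b c = base N c := by
  simp [shift, ha, hb]

lemma inCoset_shift : InCoset (shift N k a b) := fun c => by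
  refine ⟨c + (if c = a then (k : ℤ) else 0) - (if c = b then (k : ℤ) else 0), ?_⟩
  unfold shift base
  split_ifs <;> push_cast <;> ring

lemma base_eq_add_iff : base N b = base N a + k ↔ (b : ℕ) = a + k := by
  unfold base
  rw [← Nat.cast_inj (R := ℝ)]
  push_cast
  constructor <;> intro h <;> linarith

lemma signedInt_shift_of_eq_add (hab : a ≠ b) (h : (b : ℕ) = a + k) :
    signedInt (shift N k a b) = -signedInt (base N) := by
  have h' := base_eq_add_iff.2 h
  have : shift N k a b = base N ∘ Equiv.swap a b := by
    funext c
    rcases eq_or_ne c a with rfl | hca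
    · rw [shift_left hab, Function.comp_apply, Equiv.swap_apply_left, h']
    · rcases eq_or_ne c b with rfl | hcb
      · rw [shift_right hab, Function.comp_apply, Equiv.swap_apply_right, h', add_sub_cancel_right]
      · rw [shift_of_ne hca hcb, Function.comp_apply, Equiv.swap_apply_of_ne_of_ne hca hcb]
  rw [this, signedInt_perm_comp, Equiv.Perm.sign_swap hab]
  simp

lemma shift_rev (hab : a ≠ b) (hb : b = a.rev) (c : Fin N) :
    shift N k a b c.rev = -shift N k a b c := by
  have ha : a = b.rev := by rw [hb, Fin.rev_rev]
  rcases eq_or_ne c a with rfl | hca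
  · rw [← hb, shift_left hab, shift_right hab, hb, base_rev]; ring
  · rcases eq_or_ne c b with rfl | hcb
    · rw [← ha, shift_left hab, shift_right hab, ha, base_rev]; ring
    · rw [shift_of_ne hca hcb, shift_of_ne, base_rev]
      · rintro h; exact hcb (by rw [hb, ← h, Fin.rev_rev])
      · rintro h; exact hca (by rw [ha, ← h, Fin.rev_rev])

/-- Both shifted exponents leave the interval [-(N - 1)/2, (N - 1)/2], on opposite sides, so they
collide with nothing. -/
lemma shift_injective (hab : a ≠ b) (hb : b = a.rev) (hk : N ≤ a + k) :
    Function.Injective (shift N k a b) := by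
  have hgt : ((N : ℝ) - 1) / 2 < base N a + k := by
    have : (N : ℝ) ≤ a + k := by exact_mod_cast hk
    unfold base; linarith
  have hlt : base N b - k < -(((N : ℝ) - 1) / 2) := by rw [hb, base_rev]; linarith
  have hpos : (0 : ℝ) ≤ ((N : ℝ) - 1) / 2 := by
    have := base_le a
    have := neg_le_base a
    linarith
  intro c d hcd
  by_contra hne
  rcases eq_or_ne c a with rfl | hca
  · rw [shift_left hab] at hcd
    rcases eq_or_ne d b with rfl | hdb
    · rw [shift_right hab] at hcd; linarith
    · rw [shift_of_ne (Ne.symm hne) hdb] at hcd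
      linarith [base_le d]
  · rcases eq_or_ne c b with rfl | hcb
    · rw [shift_right hab] at hcd
      rcases eq_or_ne d a with rfl | hda
      · rw [shift_left hab] at hcd; linarith
      · rw [shift_of_ne hda (Ne.symm hne)] at hcd
        linarith [neg_le_base d]
    · rw [shift_of_ne hca hcb] at hcd
      rcases eq_or_ne d a with rfl | hda
      · rw [shift_left hab] at hcd; linarith [base_le c]
      · rcases eq_or_ne d b with rfl | hdb
        · rw [shift_right hab] at hcd; linarith [neg_le_base c]
        · rw [shift_of_ne hda hdb] at hcd
          exact hne (base_injective N hcd)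

/-- Only the factor of the pair {a, `a.rev`} in the Pfaffian product changes, and the combinatorial
constants cancel against those of `base N`. -/
lemma signedInt_shift_of_rev (hab : a ≠ b) (hb : b = a.rev) (hk : N ≤ a + k) :
    signedInt (shift N k a b) =
      (base N a : ℂ) / ((base N a : ℂ) + k) * signedInt (base N) := by
  have hinj := shift_injective hab hb hk
  have h1 := antisymConst_mul_signedInt_of_rev hinj inCoset_shift (shift_rev hab hb)
  have h2 := antisymConst_mul_signedInt_of_rev (base_injective N) (inCoset_base N) base_rev
  have hp : base N a ≠ 0 := by
    intro h
    refine hab (base_injective N ?_)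
    rw [hb, base_rev, h, neg_zero]
  have hpk : base N a + k ≠ 0 := by
    intro h
    have := hinj.ne hab
    rw [shift_left hab, shift_right hab, h, hb, base_rev] at this
    exact this (by linarith)
  have hp' : (base N a : ℂ) ≠ 0 := Complex.ofReal_ne_zero.2 hp
  have hpk' : (base N a : ℂ) + k ≠ 0 := by exact_mod_cast hpk
  have hpi : (π : ℂ) ≠ 0 := Complex.ofReal_ne_zero.2 Real.pi_ne_zero
  obtain ⟨j, hj⟩ := (slotEquiv N).surjective a
  have hjb : slotEquiv N (flip j) = b := by rw [slotEquiv_flip, hj, hb]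
  obtain ⟨i₀, b₀, rfl⟩ : ∃ i₀ b₀, j = Sum.inl (i₀, b₀) := by
    rcases j with ⟨i₀, b₀⟩ | u
    · exact ⟨i₀, b₀, rfl⟩
    · exact absurd (hj.symm.trans hjb) hab
  have hprod : ∏ i, Complex.I / (π * shift N k a b (slotEquiv N (Sum.inl (i, true)))) =
      (base N a : ℂ) / ((base N a : ℂ) + k) *
        ∏ i, Complex.I / (π * base N (slotEquiv N (Sum.inl (i, true)))) := by
    have : ∀ i, Complex.I / (π * shift N k a b (slotEquiv N (Sum.inl (i, true)))) =
        (if i = i₀ then (base N a : ℂ) / ((base N a : ℂ) + k) else 1) *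
          (Complex.I / (π * base N (slotEquiv N (Sum.inl (i, true))))) := by
      intro i
      split_ifs with hi
      · subst hi
        -- The `true` slot of the pair may hold a or b. In the second case numerator and denominator
        -- of the ratio both change sign.
        cases b₀
        · rw [flip_inl, Bool.not_false] at hjb
          rw [hjb, shift_right hab, hb, base_rev]
          have : -(base N a : ℂ) - k ≠ 0 := by
            rw [← neg_add']; exact neg_ne_zero.2 hpk'
          push_cast
          field_simp
          ring
        · rw [hj, shift_left hab]
          push_cast
          field_simp
      · rw [one_mul, shift_of_ne]
        · intro h
          have := (slotEquiv N).injective (h.trans hj.symm)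
          simp at this; exact hi this.1
        · intro h
          have := (slotEquiv N).injective (h.trans hjb.symm)
          simp at this; exact hi this.1
    rw [Finset.prod_congr rfl fun i _ => this i, Finset.prod_mul_distrib,
      Finset.prod_ite_eq' Finset.univ i₀ fun _ => (base N a : ℂ) / ((base N a : ℂ) + k)]
    simp
  have hC : (antisymConst (slotEquiv N) : ℂ) ≠ 0 :=
    Complex.ofReal_ne_zero.2 (antisymConst_slotEquiv_ne_zero N)
  refine mul_left_cancel₀ hC ?_
  rw [h1, hprod, mul_left_comm (antisymConst (slotEquiv N) : ℂ), h2]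
  ring

/-- Either two exponents collide, or symmetry under negation fails because the old value at a or at
b is no longer attained while its negative still is. -/
lemma signedInt_shift_eq_zero (hk : 1 ≤ k) (hab : a ≠ b) (h1 : (b : ℕ) ≠ a + k)
    (h2 : ¬ (b = a.rev ∧ N ≤ a + k)) : signedInt (shift N k a b) = 0 := by
  by_contra h0
  have hk0 : (0 : ℝ) < k := by exact_mod_cast hk
  have h1' : base N b ≠ base N a + k := fun h => h1 (base_eq_add_iff.1 h)
  have hinj : Function.Injective (shift N k a b) := by
    by_contra hni
    exact h0 (signedInt_eq_zero_of_not_injective hni)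
  obtain ⟨ρ, hρ⟩ := exists_perm_of_signedInt_ne_zero (slotEquiv N) (mod_two_le_one N)
    (antisymConst_slotEquiv_ne_zero N) inCoset_shift h0
  -- a value of `base` at `a` or `b` is attained by `shift` only in the excluded case
  have hnot : ∀ d, shift N k a b d ≠ base N a ∧ shift N k a b d ≠ base N b := by
    intro d
    rcases eq_or_ne d a with rfl | hda
    · rw [shift_left hab]
      exact ⟨by linarith, h1'.symm⟩
    · rcases eq_or_ne d b with rfl | hdb
      · rw [shift_right hab]
        exact ⟨fun h => h1' (by linarith), by linarith⟩
      · rw [shift_of_ne hda hdb]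
        exact ⟨(base_injective N).ne hda, (base_injective N).ne hdb⟩
  by_cases hb : b = a.rev
  -- The raised exponent stays in range, so it coincides with the unshifted exponent of index a + k,
  -- contradicting injectivity.
  · have hlt : (a : ℕ) + k < N := not_le.1 fun h => h2 ⟨hb, h⟩
    have hda : (⟨a + k, hlt⟩ : Fin N) ≠ a := fun h => by
      have := congrArg Fin.val h
      simp at this; omega
    have hdb : (⟨a + k, hlt⟩ : Fin N) ≠ b := fun h => h1 (congrArg Fin.val h).symm
    refine hda (hinj ?_)
    rw [shift_of_ne hda hdb, shift_left hab]
    exact base_eq_add_iff.2 rfl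
  -- If a is the middle index its exponent is 0 and its mirror image is a itself, so the obstruction
  -- is read off at b instead.
  · by_cases ha : a.rev = a
    · have hb' : b.rev ≠ b := fun h => by
        have h3 := congrArg Fin.val h
        have h4 := congrArg Fin.val ha
        simp only [Fin.val_rev] at h3 h4
        exact hab (Fin.ext (by omega))
      have hba : b.rev ≠ a := fun h => hb (by rw [← h, Fin.rev_rev])
      have := hρ b.rev
      rw [shift_of_ne hba hb', base_rev, neg_neg] at this
      exact (hnot _).2 this
    · have := hρ a.rev
      rw [shift_of_ne ha (Ne.symm hb), base_rev, neg_neg] at this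
      exact (hnot _).1 this

lemma signedInt_shift (hk : 1 ≤ k) (hab : a ≠ b) :
    signedInt (shift N k a b) = ((if (b : ℕ) = a + k then -1 else 0) +
      if b = a.rev ∧ N ≤ a + k then (base N a : ℂ) / ((base N a : ℂ) + k) else 0) *
        signedInt (base N) := by
  by_cases h1 : (b : ℕ) = a + k
  · have h2 : ¬ (b = a.rev ∧ N ≤ a + k) := fun h => by have := b.2; omega
    rw [if_pos h1, if_neg h2, signedInt_shift_of_eq_add hab h1]; ring
  · by_cases h2 : b = a.rev ∧ N ≤ a + k
    · rw [if_neg h1, if_pos h2, signedInt_shift_of_rev hab h2.1 h2.2, zero_add]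
    · rw [if_neg h1, if_neg h2, signedInt_shift_eq_zero hk hab h1 h2]; ring

end Shift

/-- The sum of the shifted integrals over all ordered pairs of distinct indices. -/
lemma sum_signedInt_shift {N k : ℕ} (hk : 1 ≤ k) :
    ∑ a : Fin N, ∑ b ∈ Finset.univ.erase a, signedInt (shift N k a b) =
      (-((N - k : ℕ) : ℂ) + ∑ a : Fin N,
        if N ≤ a + k then (base N a : ℂ) / ((base N a : ℂ) + k) else 0) *
        signedInt (base N) := by
  have h1 : ∀ a : Fin N, ∑ b ∈ Finset.univ.erase a, signedInt (shift N k a b) =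
      ((if a + k < N then (-1 : ℂ) else 0) +
        if N ≤ a + k then (base N a : ℂ) / ((base N a : ℂ) + k) else 0) *
        signedInt (base N) := by
    intro a
    rw [Finset.sum_congr rfl fun b hb => signedInt_shift hk (Finset.ne_of_mem_erase hb).symm,
      ← Finset.sum_mul, Finset.sum_add_distrib]
    congr 2
    · split_ifs with h
      · rw [Finset.sum_eq_single_of_mem (⟨a + k, h⟩ : Fin N)]
        · simp
        · refine Finset.mem_erase.2 ⟨fun h' => ?_, Finset.mem_univ _⟩
          have := congrArg Fin.val h'
          simp at this; omega
        · intro b _ hb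
          exact if_neg fun h' => hb (Fin.ext h')
      · exact Finset.sum_eq_zero fun b _ => if_neg fun h' => h (by have := b.2; omega)
    -- The middle index has no distinct partner; its exponent is 0, so the claimed term vanishes as
    -- well.
    · by_cases ha : a.rev = a
      · have h0 : base N a = 0 := by
          have := base_rev a
          rw [ha] at this
          linarith
        simp [h0]
      · split_ifs with h
        · rw [Finset.sum_eq_single_of_mem a.rev (Finset.mem_erase.2 ⟨ha, Finset.mem_univ _⟩)]
          · exact if_pos ⟨rfl, h⟩
          · intro b _ hb
            exact if_neg fun h' => hb h'.1
        · exact Finset.sum_eq_zero fun b _ => if_neg fun h' => h h'.2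
  rw [Finset.sum_congr rfl fun a _ => h1 a, ← Finset.sum_mul, Finset.sum_add_distrib]
  congr 2
  rw [← Finset.sum_filter, Finset.sum_const, nsmul_eq_mul, mul_neg_one, neg_inj]
  congr 1
  rw [show (Finset.univ.filter fun a : Fin N => (a : ℕ) + k < N) =
    Finset.univ.filter fun a : Fin N => (a : ℕ) < N - k from
      Finset.filter_congr fun a _ => by omega, Fin.card_filter_val_lt]
  omega

/-! ### The weight as a signed determinant -/

lemma wave_pow (q : ℝ) (x : Angle) (n : ℕ) : wave q x ^ n = wave (n * q) x := by
  rw [wave, wave, ← Complex.exp_nat_mul]; push_cast; ring_nf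

lemma norm_toCircle_sub (x y : Angle) :
    ((‖(x.toCircle : ℂ) - (y.toCircle : ℂ)‖ : ℝ) : ℂ) =
      -Complex.I * ((Real.sign (rep y - rep x) : ℝ) : ℂ) *
        ((y.toCircle : ℂ) - (x.toCircle : ℂ)) * (wave (-1 / 2) x * wave (-1 / 2) y) := by
  set d : ℝ := (rep y - rep x) / 2 with hd
  have hmain : ((y.toCircle : ℂ) - (x.toCircle : ℂ)) * (wave (-1 / 2) x * wave (-1 / 2) y) =
      2 * Complex.I * (Real.sin d : ℂ) := by
    rw [coe_toCircle, coe_toCircle, sub_mul]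
    simp only [wave, ← Complex.exp_add]
    rw [Complex.ofReal_sin, Complex.sin]
    have e1 : Complex.I * ((1 : ℝ) : ℂ) * rep y + (Complex.I * ((-1 / 2 : ℝ) : ℂ) * rep x +
        Complex.I * ((-1 / 2 : ℝ) : ℂ) * rep y) = d * Complex.I := by
      rw [hd]; push_cast; ring
    have e2 : Complex.I * ((1 : ℝ) : ℂ) * rep x + (Complex.I * ((-1 / 2 : ℝ) : ℂ) * rep x +
        Complex.I * ((-1 / 2 : ℝ) : ℂ) * rep y) = -d * Complex.I := by
      rw [hd]; push_cast; ring
    rw [e1, e2]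
    linear_combination (Complex.exp (d * Complex.I) - Complex.exp (-d * Complex.I)) *
      Complex.I_sq
  have hnorm : ‖(x.toCircle : ℂ) - (y.toCircle : ℂ)‖ = 2 * |Real.sin d| := by
    have := congrArg norm hmain
    rw [norm_mul, norm_mul, norm_wave, norm_wave, mul_one, mul_one, norm_mul, norm_mul,
      Complex.norm_I, Complex.norm_real, Real.norm_eq_abs, mul_one, norm_sub_rev] at this
    simpa using this
  -- Both representatives lie in (0, 2π], so d lies in (-π, π), where the sine has the sign of its
  -- argument.
  have hsign : |Real.sin d| = Real.sign (rep y - rep x) * Real.sin d := by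
    have hx0 := rep_pos x
    have hy0 := rep_pos y
    have hx1 := rep_le x
    have hy1 := rep_le y
    rcases lt_trichotomy (rep y - rep x) 0 with h | h | h
    · rw [Real.sign_of_neg h, abs_of_nonpos, neg_one_mul]
      exact Real.sin_nonpos_of_nonpos_of_neg_pi_le (by rw [hd]; linarith) (by rw [hd]; linarith)
    · rw [hd, h]; simp
    · rw [Real.sign_of_pos h, abs_of_nonneg, one_mul]
      exact Real.sin_nonneg_of_nonneg_of_le_pi (by rw [hd]; linarith) (by rw [hd]; linarith)
  rw [mul_assoc, hmain, hnorm, hsign]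
  push_cast
  linear_combination (2 * ((Real.sign (rep y - rep x) : ℝ) : ℂ) * Complex.sin d) *
    Complex.I_sq

lemma prod_prod_Ioi_mul {N : ℕ} (w : Fin N → ℂ) :
    ∏ j : Fin N, ∏ k ∈ Finset.Ioi j, (w j * w k) = ∏ j, w j ^ (N - 1) := by
  simp only [Finset.prod_mul_distrib, Finset.prod_const]
  rw [Finset.prod_comm' (t' := Finset.univ) (s' := fun k => Finset.Iio k) (by simp)]
  simp only [Finset.prod_const]
  rw [← Finset.prod_mul_distrib]
  refine Finset.prod_congr rfl fun j _ => ?_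
  rw [← pow_add, Fin.card_Ioi, Fin.card_Iio]
  congr 1
  have := j.2
  omega

/-- A Vandermonde determinant whose row j is multiplied by e^{-i(N-1)θ_j/2}, which centres the
exponents 0, …, N - 1. -/
lemma detWave_base {N : ℕ} (θ : Fin N → Angle) :
    detWave (base N) θ = (∏ j, wave (-1 / 2) (θ j) ^ (N - 1)) *
      ∏ j : Fin N, ∏ k ∈ Finset.Ioi j,
        (((θ k).toCircle : ℂ) - ((θ j).toCircle : ℂ)) := by
  rw [← Matrix.det_vandermonde fun j => ((θ j).toCircle : ℂ),
    ← Matrix.det_mul_column, detWave]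
  congr 1
  ext j a
  rw [Matrix.of_apply, Matrix.of_apply, Matrix.vandermonde_apply, coe_toCircle, wave_pow,
    wave_pow, ← wave_add]
  congr 1
  have := a.2
  unfold base
  rw [Nat.cast_sub (by omega)]
  push_cast; ring

/-- The signed determinant that represents the weight. -/
def signedDet {N : ℕ} (θ : Fin N → Angle) : ℂ := (ordSign (rep ∘ θ) : ℂ) * detWave (base N) θ

lemma exists_weight_eq (N : ℕ) :
    ∃ κ : ℂ, κ ≠ 0 ∧ ∀ θ : Fin N → Angle, (weight 1 θ : ℂ) = κ * signedDet θ := by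
  refine ⟨∏ j : Fin N, ∏ _k ∈ Finset.Ioi j, -Complex.I, ?_, fun θ => ?_⟩
  · exact Finset.prod_ne_zero_iff.2 fun _ _ => Finset.prod_ne_zero_iff.2 fun _ _ =>
      neg_ne_zero.2 Complex.I_ne_zero
  · unfold weight signedDet ordSign
    rw [detWave_base, ← prod_prod_Ioi_mul]
    push_cast
    simp only [Real.rpow_one, norm_toCircle_sub, Finset.prod_mul_distrib, Function.comp_apply]
    ring

lemma signedDet_comp_perm {N : ℕ} (θ : Fin N → Angle) (σ : Perm (Fin N)) :
    signedDet (θ ∘ σ) = signedDet θ := by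
  unfold signedDet
  rw [detWave_comp_perm, ← Function.comp_assoc, ordSign_comp_perm]
  rcases Int.units_eq_one_or (Perm.sign σ) with h | h <;> simp [h]

lemma integrable_signedDet (N : ℕ) :
    Integrable (signedDet : (Fin N → Angle) → ℂ) (torusMeasure N) :=
  integrable_ordSign_mul_detWave (base N)

lemma continuous_weight {n : ℕ} : Continuous (weight 1 : (Fin n → Angle) → ℝ) := by
  unfold weight
  simp only [Real.rpow_one]
  refine continuous_finsetProd _ fun j _ => continuous_finsetProd _ fun k _ => ?_
  have h : ∀ j : Fin n, Continuous fun θ : Fin n → Angle => ((θ j).toCircle : ℂ) := fun j =>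
    continuous_subtype_val.comp (AddCircle.continuous_toCircle.comp (continuous_apply j))
  exact ((h j).sub (h k)).norm

/-! ### Pair sums of exponentials acting on determinants -/

lemma detWave_shift {N k : ℕ} (a b : Fin N) (θ : Fin N → Angle) :
    detWave (shift N k a b) θ = ∑ σ : Perm (Fin N), ((Perm.sign σ : ℤ) : ℂ) *
      (wave k (θ (σ a)) * wave (-k) (θ (σ b)) * ∏ c, wave (base N c) (θ (σ c))) := by
  unfold detWave
  rw [Matrix.det_apply']
  refine Finset.sum_congr rfl fun σ _ => ?_
  congr 1
  have : ∀ c, wave (shift N k a b c) (θ (σ c)) = (if c = a then wave k (θ (σ c)) else 1) *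
      (if c = b then wave (-k) (θ (σ c)) else 1) * wave (base N c) (θ (σ c)) := by
    intro c
    unfold shift
    rw [sub_eq_add_neg, wave_add, wave_add]
    split_ifs <;> simp [wave_zero, mul_comm, mul_left_comm]
  simp only [Matrix.of_apply, this, Finset.prod_mul_distrib,
    Finset.prod_ite_eq' Finset.univ, Finset.mem_univ, if_true]

/-- In each term of the Leibniz expansion, substituting j = σ a and l = σ b moves the extra factors
from the angles to the exponents. -/
lemma sum_wave_mul_detWave {N k : ℕ} (θ : Fin N → Angle) :
    ∑ j, ∑ l ∈ Finset.univ.erase j, wave k (θ j) * wave (-k) (θ l) * detWave (base N) θ =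
      ∑ a, ∑ b ∈ Finset.univ.erase a, detWave (shift N k a b) θ := by
  simp only [detWave_shift]
  unfold detWave
  simp only [Matrix.det_apply', Matrix.of_apply, Finset.mul_sum]
  have hc : ∀ f : Fin N → Fin N → Perm (Fin N) → ℂ,
      ∑ a, ∑ b ∈ Finset.univ.erase a, ∑ σ, f a b σ =
        ∑ σ, ∑ a, ∑ b ∈ Finset.univ.erase a, f a b σ := fun f => by
    rw [Finset.sum_comm]
    exact Finset.sum_congr rfl fun a _ => Finset.sum_comm
  rw [hc, hc]
  refine Finset.sum_congr rfl fun σ _ => ?_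
  rw [← Equiv.sum_comp σ]
  refine Finset.sum_congr rfl fun a _ => ?_
  rw [← Finset.sum_equiv (s := Finset.univ.erase a) σ (by simp) (fun b _ => rfl)]
  exact Finset.sum_congr rfl fun b _ => by ring

lemma exists_perm_pair {n : ℕ} {j l : Fin (n + 2)} (h : j ≠ l) :
    ∃ τ : Perm (Fin (n + 2)), τ 0 = j ∧ τ 1 = l := by
  refine ⟨Equiv.swap (Equiv.swap 0 j 1) l * Equiv.swap 0 j, ?_, ?_⟩
  · rw [Perm.mul_apply, Equiv.swap_apply_left, Equiv.swap_apply_of_ne_of_ne _ h]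
    intro h'
    have := congrArg (Equiv.swap 0 j) h'
    rw [Equiv.swap_apply_right, Equiv.swap_apply_self] at this
    exact absurd this (by simp)
  · rw [Perm.mul_apply, Equiv.swap_apply_left]

/-- The correlation `∫ e^{ik(θ_j - θ_l)}` against the weight does not depend on `j ≠ l`. -/
lemma card_mul_integral_wave {n k : ℕ} (hk : 1 ≤ k) {j₀ l₀ : Fin (n + 2)} (h₀ : j₀ ≠ l₀) :
    ((n : ℂ) + 2) * ((n : ℂ) + 1) *
      ∫ θ, wave k (θ j₀) * wave (-k) (θ l₀) * signedDet θ ∂torusMeasure (n + 2) =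
    (-((n + 2 - k : ℕ) : ℂ) + ∑ a : Fin (n + 2),
        if n + 2 ≤ a + k then (base (n + 2) a : ℂ) / ((base (n + 2) a : ℂ) + k) else 0) *
        signedInt (base (n + 2)) := by
  set P : Fin (n + 2) → Fin (n + 2) → ℂ := fun j l =>
    ∫ θ, wave k (θ j) * wave (-k) (θ l) * signedDet θ ∂torusMeasure (n + 2)
  have hP01 : ∀ j l, j ≠ l → P j l = P 0 1 := by
    intro j l h
    obtain ⟨τ, rfl, rfl⟩ := exists_perm_pair h
    have := integral_comp_perm τ fun θ : Fin (n + 2) → Angle =>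
      wave k (θ 0) * wave (-k) (θ 1) * signedDet θ
    simp only [signedDet_comp_perm, Function.comp_apply] at this
    exact this
  have hint : ∀ j l : Fin (n + 2), Integrable
      (fun θ => wave k (θ j) * wave (-k) (θ l) * signedDet θ) (torusMeasure (n + 2)) := by
    intro j l
    refine (integrable_signedDet (n + 2)).bdd_mul (c := 1)
      (((measurable_wave k).comp (measurable_pi_apply j)).mul
        ((measurable_wave (-k)).comp (measurable_pi_apply l))).aestronglyMeasurable
      (Filter.Eventually.of_forall fun θ => ?_)
    change ‖wave k (θ j) * wave (-k) (θ l)‖ ≤ 1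
    rw [norm_mul, norm_wave, norm_wave, one_mul]
  rw [← sum_signedInt_shift hk]
  have h1 : ∑ a : Fin (n + 2), ∑ b ∈ Finset.univ.erase a, signedInt (shift (n + 2) k a b) =
      ∑ j, ∑ l ∈ Finset.univ.erase j, P j l := by
    unfold signedInt
    simp only [P]
    rw [Finset.sum_congr rfl fun a _ => (integral_finsetSum _ fun b _ =>
        integrable_ordSign_mul_detWave (shift (n + 2) k a b)).symm,
      ← integral_finsetSum _ fun a _ => integrable_finsetSum _ fun b _ =>
        integrable_ordSign_mul_detWave (shift (n + 2) k a b),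
      Finset.sum_congr rfl fun j _ => (integral_finsetSum _ fun l _ => hint j l).symm,
      ← integral_finsetSum _ fun j _ => integrable_finsetSum _ fun l _ => hint j l]
    congr 1
    funext θ
    simp only [← Finset.mul_sum]
    rw [← sum_wave_mul_detWave]
    simp only [Finset.mul_sum, signedDet]
    exact Finset.sum_congr rfl fun j _ => Finset.sum_congr rfl fun l _ => by ring
  rw [h1, Finset.sum_congr rfl fun j _ => Finset.sum_congr rfl fun l hl =>
    hP01 j l (Finset.ne_of_mem_erase hl).symm]
  simp only [Finset.sum_const, Finset.card_erase_of_mem (Finset.mem_univ _), Finset.card_univ,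
    Fintype.card_fin, nsmul_eq_mul]
  rw [show ∫ θ, wave k (θ j₀) * wave (-k) (θ l₀) * signedDet θ ∂torusMeasure (n + 2) = P 0 1 from
    hP01 j₀ l₀ h₀, ← mul_assoc, show n + 2 - 1 = n + 1 by omega]
  push_cast
  rfl

/-! ### Rotation invariance and reduction of the moments to integrals of the weight -/

/-- Prepend an angle. -/
def consEquiv (n : ℕ) : Angle × (Fin n → Angle) ≃ᵐ (Fin (n + 1) → Angle) :=
  (MeasurableEquiv.piFinSuccAbove (fun _ => Angle) 0).symm

lemma consEquiv_apply {n : ℕ} (z : Angle × (Fin n → Angle)) :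
    consEquiv n z = (Fin.cons z.1 z.2 : Fin (n + 1) → Angle) := by
  simp [consEquiv, MeasurableEquiv.piFinSuccAbove_symm_apply, Fin.insertNthEquiv]

lemma measurePreserving_consEquiv (n : ℕ) : MeasurePreserving (consEquiv n)
    (AddCircle.haarAddCircle.prod (torusMeasure n)) (torusMeasure (n + 1)) :=
  (measurePreserving_piFinSuccAbove
    (fun _ : Fin (n + 1) => (AddCircle.haarAddCircle : Measure Angle)) 0).symm

lemma integrable_comp_cons {n : ℕ} {f : (Fin (n + 1) → Angle) → ℂ}
    (hf : Integrable f (torusMeasure (n + 1))) :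
    Integrable (fun z : Angle × (Fin n → Angle) => f (Fin.cons z.1 z.2))
      (AddCircle.haarAddCircle.prod (torusMeasure n)) := by
  have := (measurePreserving_consEquiv n).integrable_comp_of_integrable hf
  simpa only [Function.comp_def, consEquiv_apply] using this

lemma integral_cons {n : ℕ} {f : (Fin (n + 1) → Angle) → ℂ}
    (hf : Integrable f (torusMeasure (n + 1))) :
    ∫ θ, f θ ∂torusMeasure (n + 1) =
      ∫ x, ∫ φ, f (Fin.cons x φ) ∂torusMeasure n ∂AddCircle.haarAddCircle := by
  have h := (measurePreserving_consEquiv n).integral_comp' f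
  simp only [consEquiv_apply] at h
  exact h.symm.trans (integral_prod _ (integrable_comp_cons hf))

lemma integral_add_const_complex {n : ℕ} (c : Angle) (f : (Fin n → Angle) → ℂ) :
    ∫ φ, f (fun i => c + φ i) ∂torusMeasure n = ∫ φ, f φ ∂torusMeasure n := by
  unfold torusMeasure
  exact integral_add_left_eq_self f (fun _ => c)

lemma weight_cons_add {n : ℕ} (x : Angle) (φ : Fin n → Angle) :
    weight 1 (Fin.cons x (fun i => x + φ i) : Fin (n + 1) → Angle) =
      weight 1 (Fin.cons 0 φ : Fin (n + 1) → Angle) := by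
  rw [← weight_add_const 1 x (Fin.cons 0 φ)]
  congr 1
  funext i
  refine Fin.cases ?_ (fun i => ?_) i <;> simp

lemma integrable_of_continuous {n : ℕ} {f : (Fin n → Angle) → ℂ} (hf : Continuous f) :
    Integrable f (torusMeasure n) := by
  obtain ⟨C, hC⟩ := isCompact_univ.exists_bound_of_continuousOn hf.continuousOn
  exact Integrable.of_bound hf.measurable.aestronglyMeasurable C
    (Filter.Eventually.of_forall fun θ => hC θ (Set.mem_univ _))

lemma partitionFunction_ofReal (N : ℕ) :
    (partitionFunction 1 N : ℂ) = ∫ θ, (weight 1 θ : ℂ) ∂torusMeasure N :=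
  integral_ofReal.symm

lemma continuous_weight_ofReal {n : ℕ} :
    Continuous fun θ : Fin n → Angle => (weight 1 θ : ℂ) :=
  Complex.continuous_ofReal.comp continuous_weight

/-- A function of the angles relative to the first one, averaged against the weight. -/
lemma integral_sub_mul_weight {n : ℕ} {f : (Fin n → Angle) → ℂ} (hf : Continuous f) :
    ∫ θ : Fin (n + 1) → Angle, f (fun i => θ i.succ - θ 0) * (weight 1 θ : ℂ)
        ∂torusMeasure (n + 1) =
      ∫ φ, f φ * (weight 1 (Fin.cons 0 φ : Fin (n + 1) → Angle) : ℂ) ∂torusMeasure n := by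
  rw [integral_cons]
  · have : ∀ x : Angle, ∫ φ : Fin n → Angle,
        f (fun i => (Fin.cons x φ : Fin (n + 1) → Angle) i.succ -
          (Fin.cons x φ : Fin (n + 1) → Angle) 0) *
        (weight 1 (Fin.cons x φ : Fin (n + 1) → Angle) : ℂ) ∂torusMeasure n =
        ∫ φ, f φ * (weight 1 (Fin.cons 0 φ : Fin (n + 1) → Angle) : ℂ) ∂torusMeasure n := by
      intro x
      -- Translating the remaining angles by x removes the dependence on x, and the outer measure
      -- has mass one.
      rw [← integral_add_const_complex x]
      simp only [Fin.cons_succ, Fin.cons_zero, add_sub_cancel_left, weight_cons_add]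
    simp only [this]
    simp
  · refine integrable_of_continuous (Continuous.mul (hf.comp ?_) continuous_weight_ofReal)
    fun_prop

lemma partitionFunction_ne_zero (N : ℕ) : (partitionFunction 1 N : ℂ) ≠ 0 := by
  obtain ⟨κ, hκ, hw⟩ := exists_weight_eq N
  rw [partitionFunction_ofReal]
  simp only [hw]
  rw [integral_const_mul]
  exact mul_ne_zero hκ (signedInt_base_ne_zero N)

lemma rho1_zero (n : ℕ) : rho1 1 (n + 1) 0 = n + 1 := by
  have h := integral_sub_mul_weight (n := n) (f := fun _ => 1) continuous_const
  simp only [one_mul] at h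
  rw [← partitionFunction_ofReal, integral_complex_ofReal] at h
  have h' : partitionFunction 1 (n + 1) =
      ∫ φ, weight 1 (Fin.cons 0 φ : Fin (n + 1) → Angle) ∂torusMeasure n := by exact_mod_cast h
  have hZ : partitionFunction 1 (n + 1) ≠ 0 := by
    exact_mod_cast partitionFunction_ne_zero (n + 1)
  unfold rho1
  change ((n + 1 : ℕ) : ℝ) / partitionFunction 1 (n + 1) *
    ∫ φ, weight 1 (Fin.cons 0 φ : Fin (n + 1) → Angle) ∂torusMeasure n = _
  rw [← h', div_mul_cancel₀ _ hZ, Nat.cast_add_one]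

lemma rho1_eq (n : ℕ) (x : Angle) : rho1 1 (n + 1) x = n + 1 := by
  rw [← rho1_zero n]
  unfold rho1
  rw [← integral_add_const x]
  congr 2
  funext φ
  exact weight_cons_add x φ

lemma fourier_eq_wave (k : ℤ) (x : Angle) : (fourier k x : ℂ) = wave k x := by
  rw [fourier_apply]
  conv_lhs => rw [← coe_rep x]
  rw [← AddCircle.coe_zsmul, AddCircle.toCircle_apply_mk, Circle.coe_exp, wave]
  congr 1
  rw [zsmul_eq_mul]
  push_cast
  field_simp

lemma integrable_fourier_mul_weight_cons (n : ℕ) (k : ℤ) :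
    Integrable (fun φ : Fin (n + 1) → Angle => (fourier k (φ 0) : ℂ) *
      (weight 1 (Fin.cons 0 φ : Fin (n + 2) → Angle) : ℂ)) (torusMeasure (n + 1)) := by
  have hc : Continuous fun φ : Fin (n + 1) → Angle => (fourier k (φ 0) : ℂ) :=
    (fourier k).continuous.comp (continuous_apply 0)
  have hcons : Continuous fun φ : Fin (n + 1) → Angle =>
      (Fin.cons 0 φ : Fin (n + 2) → Angle) := by
    refine continuous_pi fun i => ?_
    refine Fin.cases ?_ (fun i => ?_) i
    · simpa using continuous_const
    · simpa using continuous_apply i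
  exact integrable_of_continuous (hc.mul (continuous_weight_ofReal.comp hcons))

lemma fourier_mul_rho2 (n : ℕ) (k : ℤ) (x : Angle) :
    (fourier k x : ℂ) * (rho2 1 (n + 2) 0 x : ℂ) =
      ((n : ℂ) + 2) * ((n : ℂ) + 1) / (partitionFunction 1 (n + 2) : ℂ) *
        ∫ φ : Fin n → Angle, (fourier k ((Fin.cons x φ : Fin (n + 1) → Angle) 0) : ℂ) *
          (weight 1 (Fin.cons 0 (Fin.cons x φ : Fin (n + 1) → Angle) : Fin (n + 2) → Angle) : ℂ)
          ∂torusMeasure n := by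
  simp only [Fin.cons_zero]
  rw [integral_const_mul, integral_complex_ofReal]
  have : rho2 1 (n + 2) 0 x = ((n + 2 : ℕ) : ℝ) * (((n + 2 : ℕ) : ℝ) - 1) /
      partitionFunction 1 (n + 2) * ∫ φ : Fin n → Angle,
        weight 1 (Fin.cons 0 (Fin.cons x φ : Fin (n + 1) → Angle) : Fin (n + 2) → Angle)
        ∂torusMeasure n := rfl
  rw [this]
  push_cast
  ring

lemma integral_fourier_mul_rho2 (n : ℕ) (k : ℤ) :
    ∫ x : Angle, (fourier k x : ℂ) * (rho2 1 (n + 2) 0 x : ℂ) ∂AddCircle.haarAddCircle =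
      ((n : ℂ) + 2) * ((n : ℂ) + 1) / (partitionFunction 1 (n + 2) : ℂ) *
        ∫ θ : Fin (n + 2) → Angle, (fourier k (θ 1 - θ 0) : ℂ) * (weight 1 θ : ℂ)
          ∂torusMeasure (n + 2) := by
  have h := integral_sub_mul_weight (n := n + 1) (f := fun φ => (fourier k (φ 0) : ℂ))
    ((fourier k).continuous.comp (continuous_apply 0))
  have h01 : ∀ θ : Fin (n + 2) → Angle, θ (Fin.succ 0) = θ 1 := fun _ => rfl
  simp only [h01] at h
  rw [h, integral_cons (integrable_fourier_mul_weight_cons n k), ← integral_const_mul]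
  simp only [fourier_mul_rho2]

lemma integrable_fourier_mul_rho2 (n : ℕ) (k : ℤ) :
    Integrable (fun x : Angle => (fourier k x : ℂ) * (rho2 1 (n + 2) 0 x : ℂ))
      AddCircle.haarAddCircle := by
  simp only [fourier_mul_rho2]
  exact (integrable_comp_cons
    (integrable_fourier_mul_weight_cons n k)).integral_prod_left.const_mul _

lemma integral_fourier (k : ℤ) :
    ∫ x : Angle, (fourier k x : ℂ) ∂AddCircle.haarAddCircle = if k = 0 then 1 else 0 := by
  simp only [fourier_eq_wave]
  change singleInt k = _
  split_ifs with h
  · rw [h, Int.cast_zero, singleInt_zero]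
  · exact singleInt_intCast rfl (Int.cast_ne_zero.2 h)

/-- The prefactor annihilates ρ_(2), leaving the constant -1. This case is kept apart because no
second angle exists. -/
lemma moment_one (k : ℤ) : moment 1 1 k = -(if k = 0 then 1 else 0) := by
  have h : ∀ x, rho2C 1 1 0 x = -1 := fun x => by
    have h1 := rho1_eq 0 x
    have h0 := rho1_eq 0 0
    norm_num at h1 h0
    unfold rho2C rho2
    rw [h1, h0]; simp
  unfold moment fourierCoeff
  simp only [h, smul_eq_mul]
  rw [integral_mul_const, integral_fourier]
  simp [neg_eq_zero]

lemma moment_add_two (n : ℕ) (k : ℤ) :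
    moment 1 (n + 2) k = ((n : ℂ) + 2) * ((n : ℂ) + 1) / (partitionFunction 1 (n + 2) : ℂ) *
        (∫ θ : Fin (n + 2) → Angle, (fourier (-k) (θ 1 - θ 0) : ℂ) * (weight 1 θ : ℂ)
          ∂torusMeasure (n + 2)) - if k = 0 then ((n : ℂ) + 2) ^ 2 else 0 := by
  have h : ∀ x, ((rho2C 1 (n + 2) 0 x : ℝ) : ℂ) =
      (rho2 1 (n + 2) 0 x : ℂ) - ((n : ℂ) + 2) ^ 2 := fun x => by
    unfold rho2C
    rw [rho1_eq (n + 1), rho1_eq (n + 1)]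
    push_cast; ring
  unfold moment fourierCoeff
  simp only [h, smul_eq_mul, mul_sub]
  rw [integral_sub (integrable_fourier_mul_rho2 n (-k)), integral_fourier_mul_rho2,
    integral_mul_const, integral_fourier]
  · congr 1
    simp [neg_eq_zero]
  · simp only [fourier_eq_wave]
    exact (Integrable.of_bound (measurable_wave _).aestronglyMeasurable 1
      (Filter.Eventually.of_forall fun x => (norm_wave _ x).le)).mul_const _

lemma fourier_sub_apply (k : ℤ) (x y : Angle) :
    (fourier k (x - y) : ℂ) = wave k x * wave (-k) y := by
  have : (fourier k (x - y) : ℂ) = (fourier k x : ℂ) * (fourier (-k) y : ℂ) := by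
    simp only [fourier_apply]
    rw [smul_sub, sub_eq_add_neg, ← neg_zsmul, AddCircle.toCircle_add, Circle.coe_mul]
  rw [this, fourier_eq_wave, fourier_eq_wave, Int.cast_neg]

/-! ### The closed form of the moments -/

/-- A rational expression for the moments of the circular orthogonal ensemble. -/
def closedMoment (N k : ℕ) : ℝ :=
  -((N - k : ℕ) : ℝ) + ∑ i ∈ Finset.range (min k N),
    (1 - (k : ℝ) / (((N : ℝ) + 1) / 2 + ((k - N : ℕ) : ℝ) + i))

lemma closedMoment_eq (N k : ℕ) : (closedMoment N k : ℂ) = -((N - k : ℕ) : ℂ) + ∑ a : Fin N,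
    if N ≤ a + k then (base N a : ℂ) / ((base N a : ℂ) + k) else 0 := by
  unfold closedMoment
  push_cast
  congr 1
  have h : ∑ a : Fin N, (if N ≤ a + k then (base N a : ℂ) / ((base N a : ℂ) + k) else 0) =
      ∑ a ∈ Finset.range N, (if N ≤ a + k then
        ((a : ℂ) - ((N : ℂ) - 1) / 2) / ((a : ℂ) - ((N : ℂ) - 1) / 2 + k) else 0) := by
    rw [Finset.sum_range]
    refine Finset.sum_congr rfl fun a _ => ?_
    unfold base
    push_cast; rfl
  -- The indices a < N - k contribute nothing and the rest are a = N - k + i. For k > N the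
  -- truncated difference is 0 and every index counts.
  have hN : N = (N - k) + min k N := by omega
  rw [h]
  conv_rhs => rw [Finset.sum_congr (congrArg Finset.range hN) fun _ _ => rfl]
  rw [Finset.sum_range_add, Finset.sum_eq_zero (s := Finset.range (N - k)), zero_add]
  · refine Finset.sum_congr rfl fun i _ => ?_
    rw [if_pos (by omega)]
    have hcast : ((N - k : ℕ) : ℂ) + k = N + ((k - N : ℕ) : ℂ) := by
      exact_mod_cast (by omega : (N - k) + k = N + (k - N))
    have hden : ((N - k + i : ℕ) : ℂ) - ((N : ℂ) - 1) / 2 + k =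
        ((N : ℂ) + 1) / 2 + ((k - N : ℕ) : ℂ) + i := by
      push_cast
      linear_combination hcast
    have hne : ((N : ℂ) + 1) / 2 + ((k - N : ℕ) : ℂ) + i ≠ 0 := by
      have : (0 : ℝ) < ((N : ℝ) + 1) / 2 + ((k - N : ℕ) : ℝ) + i := by positivity
      have h' := Complex.ofReal_ne_zero.2 this.ne'
      push_cast at h'
      exact h'
    rw [hden, eq_div_iff hne, sub_mul, div_mul_cancel₀ _ hne, one_mul, ← hden]
    ring
  · intro a ha
    rw [if_neg]
    have := Finset.mem_range.1 ha
    omega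

lemma closedMoment_one {k : ℕ} (hk : 1 ≤ k) : closedMoment 1 k = 0 := by
  unfold closedMoment
  have h1 : min k 1 = 1 := by omega
  have h2 : 1 - k = 0 := by omega
  have h3 : ((1 + 1 : ℝ) / 2 + ((k - 1 : ℕ) : ℝ) + ((0 : ℕ) : ℝ)) = k := by
    rw [Nat.cast_sub hk]; push_cast; ring
  rw [h1, h2, Finset.sum_range_one, Nat.cast_one, h3, div_self (by positivity)]
  simp

/-- Serves both signs of z: reversing the sign exchanges j and l, and the integral is the same for
every pair j ≠ l. -/
lemma moment_eq_of_integral {n k : ℕ} {z : ℤ} (hz : z ≠ 0) (hk : 1 ≤ k) {j l : Fin (n + 2)}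
    (hjl : j ≠ l) (h : ∀ θ : Fin (n + 2) → Angle, (fourier (-z) (θ 1 - θ 0) : ℂ) =
      wave k (θ j) * wave (-k) (θ l)) :
    moment 1 (n + 2) z = closedMoment (n + 2) k := by
  obtain ⟨κ, hκ, hw⟩ := exists_weight_eq (n + 2)
  have hZ : (partitionFunction 1 (n + 2) : ℂ) = κ * signedInt (base (n + 2)) := by
    rw [partitionFunction_ofReal]
    simp only [hw]
    rw [integral_const_mul]
    rfl
  have hI : ∫ θ : Fin (n + 2) → Angle, (fourier (-z) (θ 1 - θ 0) : ℂ) * (weight 1 θ : ℂ)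
      ∂torusMeasure (n + 2) =
      κ * ∫ θ, wave k (θ j) * wave (-k) (θ l) * signedDet θ ∂torusMeasure (n + 2) := by
    rw [← integral_const_mul]
    congr 1
    funext θ
    rw [h, hw]; ring
  have hT := signedInt_base_ne_zero (n + 2)
  rw [moment_add_two, if_neg hz, sub_zero, hI, hZ, closedMoment_eq]
  have := card_mul_integral_wave hk hjl
  rw [div_mul_eq_mul_div, div_eq_iff (mul_ne_zero hκ hT)]
  linear_combination κ * this

lemma moment_natCast {N k : ℕ} (hN : 1 ≤ N) (hk : 1 ≤ k) :
    moment 1 N (k : ℤ) = closedMoment N k := by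
  have hk0 : (k : ℤ) ≠ 0 := by omega
  obtain rfl | ⟨n, rfl⟩ : N = 1 ∨ ∃ n, N = n + 2 := by
    rcases N with _ | _ | n
    · omega
    · exact Or.inl rfl
    · exact Or.inr ⟨n, rfl⟩
  · rw [moment_one, if_neg hk0, closedMoment_one hk]; simp
  · refine moment_eq_of_integral hk0 hk (j := 0) (l := 1) (by simp) fun θ => ?_
    rw [fourier_sub_apply, mul_comm]
    push_cast
    rw [neg_neg]

lemma moment_neg_natCast {N k : ℕ} (hN : 1 ≤ N) (hk : 1 ≤ k) :
    moment 1 N (-(k : ℤ)) = closedMoment N k := by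
  have hk0 : -(k : ℤ) ≠ 0 := by omega
  obtain rfl | ⟨n, rfl⟩ : N = 1 ∨ ∃ n, N = n + 2 := by
    rcases N with _ | _ | n
    · omega
    · exact Or.inl rfl
    · exact Or.inr ⟨n, rfl⟩
  · rw [moment_one, if_neg hk0, closedMoment_one hk]; simp
  · refine moment_eq_of_integral hk0 hk (j := 1) (l := 0) (by simp) fun θ => ?_
    rw [fourier_sub_apply]
    push_cast
    rw [neg_neg]

lemma moment_zero {N : ℕ} (hN : 1 ≤ N) : moment 1 N 0 = -(N : ℂ) := by
  obtain rfl | ⟨n, rfl⟩ : N = 1 ∨ ∃ n, N = n + 2 := by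
    rcases N with _ | _ | n
    · omega
    · exact Or.inl rfl
    · exact Or.inr ⟨n, rfl⟩
  · rw [moment_one]; simp
  · have hZ := partitionFunction_ne_zero (n + 2)
    rw [moment_add_two, if_pos rfl]
    simp only [neg_zero, fourier_zero, one_mul]
    rw [← partitionFunction_ofReal, div_mul_cancel₀ _ hZ]
    push_cast; ring

/-! ### Digamma and partial fraction forms -/

lemma digamma_add_natCast_sub {s : ℝ} (hs : 0 < s) (m : ℕ) :
    Complex.digamma ((s : ℂ) + m) - Complex.digamma s =
      ∑ i ∈ Finset.range m, 1 / ((s : ℂ) + i) := by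
  induction m with
  | zero => simp
  | succ m ih =>
    rw [Finset.sum_range_succ, ← ih, Nat.cast_succ, ← add_assoc, Complex.digamma_apply_add_one,
      one_div]
    · ring
    · intro j h
      have h' : s + m = -(j : ℝ) := by exact_mod_cast h
      have : (0 : ℝ) < s + m := by positivity
      have : (0 : ℝ) ≤ j := by positivity
      linarith

lemma closedMoment_eq_digamma (N k : ℕ) :
    (closedMoment N k : ℂ) = -((N - k : ℕ) : ℂ) - (-((min k N : ℕ) : ℂ) +
      (k : ℂ) * (Complex.digamma (((N : ℂ) + 1) / 2 + k) -
        Complex.digamma (((N : ℂ) + 1) / 2 + ((k - N : ℕ) : ℂ)))) := by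
  have hs : (0 : ℝ) < ((N : ℝ) + 1) / 2 + ((k - N : ℕ) : ℝ) := by positivity
  have h := digamma_add_natCast_sub hs (min k N)
  have hk : ((k - N : ℕ) : ℂ) + ((min k N : ℕ) : ℂ) = k := by
    exact_mod_cast (by omega : (k - N) + min k N = k)
  push_cast [-Nat.cast_min] at h
  rw [add_assoc, hk] at h
  rw [h]
  unfold closedMoment
  push_cast [-Nat.cast_min]
  rw [Finset.sum_sub_distrib, Finset.mul_sum, Finset.sum_const, Finset.card_range, nsmul_eq_mul]
  simp only [mul_one_div]
  ring

lemma closedMoment_of_le {N k : ℕ} (hk : k ≤ N) : closedMoment N k =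
    -(N : ℝ) + 2 * k - k * ∑ i ∈ Finset.range k, 1 / (((N : ℝ) + 1) / 2 + i) := by
  unfold closedMoment
  rw [min_eq_left hk, Nat.sub_eq_zero_of_le hk, Nat.cast_sub hk, Finset.sum_sub_distrib,
    Finset.mul_sum, Finset.sum_const, Finset.card_range, nsmul_eq_mul]
  simp only [Nat.cast_zero, add_zero, mul_one_div]
  ring

lemma closedMoment_partialFraction {N k : ℕ} (hk : k ≤ N + 1) : closedMoment N k =
    -(N : ℝ) + 2 * k - 2 * k * ∑ j ∈ Finset.Icc 1 k, 1 / ((N : ℝ) + 2 * j - 1) := by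
  have hsum : 2 * ∑ j ∈ Finset.Icc 1 k, 1 / ((N : ℝ) + 2 * j - 1) =
      ∑ i ∈ Finset.range k, 1 / (((N : ℝ) + 1) / 2 + i) := by
    rw [← Finset.Ico_add_one_right_eq_Icc, Finset.sum_Ico_eq_sum_range, Finset.mul_sum]
    refine Finset.sum_congr (by simp) fun i _ => ?_
    have h1 : (0 : ℝ) < ((N : ℝ) + 1) / 2 + i := by positivity
    have h2 : (N : ℝ) + 2 * ((1 + i : ℕ) : ℝ) - 1 = 2 * (((N : ℝ) + 1) / 2 + i) := by
      push_cast; ring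
    rw [h2]
    field_simp
  rw [mul_comm (2 : ℝ) (k : ℝ), mul_assoc (k : ℝ), hsum]
  rcases Nat.lt_or_ge N k with h | h
  · obtain rfl : k = N + 1 := by omega
    rw [Finset.sum_range_succ']
    unfold closedMoment
    rw [min_eq_right h.le, Nat.sub_eq_zero_of_le h.le, Finset.sum_sub_distrib, Finset.sum_const,
      Finset.card_range, nsmul_eq_mul, mul_add, Finset.mul_sum]
    have h2 : ∀ i : ℕ, ((N + 1 : ℕ) : ℝ) / (((N : ℝ) + 1) / 2 + ((N + 1 - N : ℕ) : ℝ) + i) =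
        ((N + 1 : ℕ) : ℝ) * (1 / (((N : ℝ) + 1) / 2 + ((i + 1 : ℕ) : ℝ))) := fun i => by
      rw [Nat.add_sub_cancel_left, mul_one_div]
      push_cast
      ring_nf
    -- At k = N + 1 the partial fraction sum has one extra term, equal to exactly 2. It offsets the
    -- surplus in -N + 2k, so the formula valid for k ≤ N extends one step further.
    have h3 : ((N + 1 : ℕ) : ℝ) * (1 / (((N : ℝ) + 1) / 2 + ((0 : ℕ) : ℝ))) = 2 := by
      have : (0 : ℝ) < (N : ℝ) + 1 := by positivity
      push_cast
      rw [add_zero]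
      field_simp
    rw [h3, Finset.sum_congr rfl fun i _ => h2 i]
    push_cast; ring
  · rw [closedMoment_of_le h]; ring

/-! ### Negativity of the moments -/

/-- With x_i = i - (N - 1)/2, each summand is x_i/(k + x_i) = x_i/k - x_i²/(k(k + x_i)). The linear
parts cancel by symmetry and the quadratic parts are nonpositive; N ≥ 2 gives x_0 ≠ 0, hence
strictness. -/
lemma closedMoment_neg_of_ge {N k : ℕ} (hN : 2 ≤ N) (hk : N ≤ k) : closedMoment N k < 0 := by
  unfold closedMoment
  rw [min_eq_right hk, Nat.sub_eq_zero_of_le hk, Nat.cast_zero, neg_zero, zero_add]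
  have hN' : (2 : ℝ) ≤ N := by exact_mod_cast hN
  have hk' : (N : ℝ) ≤ k := by exact_mod_cast hk
  have hk0 : (0 : ℝ) < k := by linarith
  set x : ℕ → ℝ := fun i => (i : ℝ) - ((N : ℝ) - 1) / 2 with hx
  have hpos : ∀ i : ℕ, 0 < (k : ℝ) + x i := fun i => by
    have : (0 : ℝ) ≤ i := by positivity
    simp only [hx]; linarith
  have hterm : ∀ i : ℕ, 1 - (k : ℝ) / (((N : ℝ) + 1) / 2 + ((k - N : ℕ) : ℝ) + i) =
      x i / k - x i ^ 2 / (k * (k + x i)) := fun i => by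
    have h1 : ((N : ℝ) + 1) / 2 + ((k - N : ℕ) : ℝ) + i = k + x i := by
      rw [Nat.cast_sub hk]; simp only [hx]; ring
    have := (hpos i).ne'
    rw [h1]
    field_simp
    ring
  have hsum : ∑ i ∈ Finset.range N, x i / k = 0 := by
    rw [← Finset.sum_div, Finset.sum_sub_distrib, Finset.sum_const, Finset.card_range,
      nsmul_eq_mul, ← Nat.cast_sum]
    have := Finset.sum_range_id_mul_two N
    have h2 : ((∑ i ∈ Finset.range N, i : ℕ) : ℝ) * 2 = N * (N - 1) := by
      have h3 := congrArg (Nat.cast : ℕ → ℝ) this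
      rw [Nat.cast_mul, Nat.cast_mul, Nat.cast_sub (by omega)] at h3
      exact_mod_cast h3
    rw [div_eq_zero_iff]
    left
    linarith
  rw [Finset.sum_congr rfl fun i _ => hterm i, Finset.sum_sub_distrib, hsum, zero_sub,
    neg_lt_zero]
  refine Finset.sum_pos' (fun i _ => ?_) ⟨0, Finset.mem_range.2 (by omega), ?_⟩
  · have := hpos i
    positivity
  · have h0 := hpos 0
    have : x 0 ≠ 0 := by
      simp only [hx, Nat.cast_zero]
      intro h; linarith
    positivity

/-- Writing c_k for the closed form, the harmonic sums cancel in (k + 1) c_k - k c_{k+1} = k(k + 1)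
t - N, with t the last summand at k + 1. This is at most 0 because k + 1 ≤ N. -/
lemma closedMoment_neg_of_succ {N k : ℕ} (hk : 1 ≤ k) (hkN : k + 1 ≤ N)
    (h : closedMoment N (k + 1) < 0) : closedMoment N k < 0 := by
  rw [closedMoment_of_le (by omega)] at h ⊢
  rw [Finset.sum_range_succ] at h
  set S := ∑ i ∈ Finset.range k, 1 / (((N : ℝ) + 1) / 2 + i)
  have hk0 : (1 : ℝ) ≤ k := by exact_mod_cast hk
  have hkN' : (k : ℝ) + 1 ≤ N := by exact_mod_cast hkN
  push_cast at h
  set t := 1 / (((N : ℝ) + 1) / 2 + k) with ht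
  have hden : 0 < ((N : ℝ) + 1) / 2 + k := by positivity
  have hbound : k * (k + 1) * t ≤ N := by
    rw [ht, mul_one_div, div_le_iff₀ hden]
    nlinarith
  have h2 := mul_neg_of_pos_of_neg (by linarith : (0 : ℝ) < k) h
  have h3 : ((k : ℝ) + 1) * (-N + 2 * k - k * S) < 0 := by nlinarith
  exact neg_of_mul_neg_right h3 (by linarith)

lemma closedMoment_neg {N k : ℕ} (hN : 2 ≤ N) (hk : 1 ≤ k) : closedMoment N k < 0 := by
  rcases le_or_gt N k with h | h
  · exact closedMoment_neg_of_ge hN h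
  -- Descent towards k from the range k ≥ N: here N = k + d + 1, and d = 0 puts k + 1 in that range.
  · obtain ⟨d, hd⟩ := Nat.exists_eq_add_of_lt h
    clear h
    induction d generalizing k with
    | zero =>
      have h1 := closedMoment_neg_of_ge hN (k := k + 1) (by omega)
      exact closedMoment_neg_of_succ hk (by omega) h1
    | succ d ih =>
      exact closedMoment_neg_of_succ hk (by omega) (ih (k := k + 1) (by omega) (by omega))

end CircularEnsemble

end

theorem proposition5p3 (N : ℕ) (hN : 1 ≤ N) :
    -- the explicit formulae
    CircularEnsemble.moment 1 N 0 = -(N : ℂ) ∧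
    (∀ k : ℤ, 1 ≤ k →
      CircularEnsemble.moment 1 N k =
        -((max ((N : ℤ) - |k|) 0 : ℤ) : ℂ) -
          (-((min k (N : ℤ) : ℤ) : ℂ) +
            (k : ℂ) * (Complex.digamma (((N : ℂ) + 1) / 2 + (k : ℂ)) -
              Complex.digamma (((N : ℂ) + 1) / 2 + ((max 0 (k - (N : ℤ)) : ℤ) : ℂ))))) ∧
    (∀ k : ℤ, k ≤ -1 →
      CircularEnsemble.moment 1 N k =
        -((max ((N : ℤ) - |k|) 0 : ℤ) : ℂ) -
          (-((min (-k) (N : ℤ) : ℤ) : ℂ) -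
            (k : ℂ) * (Complex.digamma (((N : ℂ) + 1) / 2 - (k : ℂ)) -
              Complex.digamma (((N : ℂ) + 1) / 2 + ((max 0 (-k - (N : ℤ)) : ℤ) : ℂ))))) ∧
    -- no moment vanishes
    (2 ≤ N → ∀ k : ℤ, CircularEnsemble.moment 1 N k ≠ 0) ∧
    -- the partial fraction form
    (∀ k : ℕ, 1 ≤ k → k ≤ N + 1 →
      CircularEnsemble.moment 1 N (k : ℤ) =
        -(N : ℂ) + 2 * (k : ℂ) -
          2 * (k : ℂ) * ∑ j ∈ Finset.Icc 1 k, 1 / ((N : ℂ) + 2 * (j : ℂ) - 1)) := by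
  have hint : ∀ k : ℕ, max ((N : ℤ) - |(k : ℤ)|) 0 = ((N - k : ℕ) : ℤ) ∧
      min (k : ℤ) N = ((min k N : ℕ) : ℤ) ∧ max 0 ((k : ℤ) - N) = ((k - N : ℕ) : ℤ) := fun k => by
    rw [Nat.abs_cast]
    omega
  refine ⟨CircularEnsemble.moment_zero hN, fun k hk => ?_, fun k hk => ?_, fun hN2 k => ?_,
    fun k hk hkN => ?_⟩
  · lift k to ℕ using by omega
    obtain ⟨h1, h2, h3⟩ := hint k
    rw [CircularEnsemble.moment_natCast hN (by omega), CircularEnsemble.closedMoment_eq_digamma,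
      h1, h2, h3]
    simp only [Int.cast_natCast]
  · obtain ⟨j, rfl⟩ : ∃ j : ℕ, k = -(j : ℤ) := ⟨k.natAbs, by omega⟩
    obtain ⟨h1, h2, h3⟩ := hint j
    rw [CircularEnsemble.moment_neg_natCast hN (by omega),
      CircularEnsemble.closedMoment_eq_digamma, abs_neg, neg_neg, h1, h2, h3]
    simp only [Int.cast_natCast, Int.cast_neg, sub_neg_eq_add, neg_mul]
  · rcases lt_trichotomy k 0 with h | rfl | h
    · obtain ⟨j, rfl⟩ : ∃ j : ℕ, k = -(j : ℤ) := ⟨k.natAbs, by omega⟩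
      rw [CircularEnsemble.moment_neg_natCast hN (by omega)]
      exact_mod_cast (CircularEnsemble.closedMoment_neg hN2 (by omega)).ne
    · rw [CircularEnsemble.moment_zero hN]
      exact neg_ne_zero.2 (Nat.cast_ne_zero.2 (by omega))
    · lift k to ℕ using h.le
      rw [CircularEnsemble.moment_natCast hN (by omega)]
      exact_mod_cast (CircularEnsemble.closedMoment_neg hN2 (by omega)).ne
  · rw [CircularEnsemble.moment_natCast hN hk, CircularEnsemble.closedMoment_partialFraction hkN]
    push_cast
    rfl
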